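/- A quantum channel is a completely positive, trace-preserving linear map $\Phi:M_a(\mathbb C)\to M_b(\mathbb C)$. If $W:\mathbb C^a\to\mathbb C^b\otimes\mathbb C^d$ is an isometry with $\Phi(\rho)=\mathrm{Tr}_E\,W\rho W^\dagger$ (trace over the environment $E=\mathbb C^d$), then $\rho\mapsto \mathrm{Tr}_B\,W\rho W^\dagger$ (trace over the output $B=\mathbb C^b$) is a complementary channel of $\Phi$, written $\Phi^C$. The channel $\Phi$ is degradable if $\Psi\circ\Phi=\Phi^C$ for some channel $\Psi$, and anti-degradable if $\Psi\circ\Phi^C=\Phi$ for some channel $\Psi$. Its Choi rank is the rank of $\sum_{i,j}|i\rangle\langle j|\otimes\Phi(|i\rangle\langle j|)$. Two maps $\Phi,\Phi'$ on $M_2$ agree up to unitary conjugations if $\Phi(\rho)=U\,\Phi'(V\rho V^\dagger)\,U^\dagger$ for all $\rho$, for some unitaries $U,V$. For $u,v\in\mathbb R$ let $\Phi(u,v):M_2\to M_2$ be the linear map with $$I\mapsto I+\sin u\sin v\,\sigma_z,\quad \sigma_x\mapsto\cos u\,\sigma_x,\quad \sigma_y\mapsto\cos v\,\sigma_y,\quad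 \sigma_z\mapsto\cos u\cos v\,\sigma_z,$$ and let $$A_+=\begin{pmatrix}\cos\frac{v-u}2&0\\0&\cos\frac{u+v}2\end{pmatrix}=\cos\tfrac v2\cos\tfrac u2\, I+\sin\tfrac v2\sin\tfrac u2\,\sigma_z,$$ $$A_-=\begin{pmatrix}0&\sin\frac{u+v}2\\\sin\frac{v-u}2&0\end{pmatrix}=\sin\tfrac v2\cos\tfrac u2\,\sigma_x+i\cos\tfrac v2\sin\tfrac u2\,\sigma_y .$$ Then the following hold. (0) For all $u,v$, $\Phi(u,v)(\rho)=A_+\rho A_+^\dagger+A_-\rho A_-^\dagger$, and $\Phi(u,v)$ is a channel. (1) A channel $\Phi:M_2\to M_2$ is degradable if and only if, up to unitary conjugations on the input and output, it equals $\Phi(u,v)$ for some real $u,v$ with $|\sin v|\le|\cos u|$. (2) Every degradable channel $\Phi:M_2\to M_2$ has Choi rank two, or else has Choi rank one and is a unitary conjugation $\rho\mapsto U\rho U^\dagger$. (3) If $|\sin v|\ge|\cos u|$, every map that equals $\Phi(u,v)$ up to unitary conjugations is anti-degradable. (4) For all $u,v$, $\Phi(v-\frac\pi2,u-\frac\pi2)$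 is a complementary channel of $\Phi(u,v)$: $\Phi^C(u,v)=\Phi(v-\frac\pi2,u-\frac\pi2)$. (5) If $|\sin v|\le|\cos u|$, then $\Phi(\theta_1,\theta_2)\circ\Phi(u,v)=\Phi(v-\frac\pi2,u-\frac\pi2)$ for all real $\theta_1,\theta_2$ with $\cos u\cos\theta_1=\sin v$, $\cos v\cos\theta_2=\sin u$ and $\cos u\cos v\,\sin\theta_1\sin\theta_2\ge0$. In particular this holds for $$\theta_1=\varepsilon\arccos\frac{\sin v}{\cos u},\qquad \theta_2=\arccos\frac{\sin u}{\cos v},$$ where $\varepsilon=-1$ if $\cos u\cos v<0$ and $\varepsilon=1$ otherwise, and $\frac00$ is read as $0$. -/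

import Mathlib

open scoped Matrix ComplexOrder

noncomputable section

/-- The map `id_k ⊗ Φ` on `k × k` block matrices: `Φ` is applied to every block. -/
def ampliation {n m : Type} (k : ℕ) (Φ : Matrix n n ℂ →ₗ[ℂ] Matrix m m ℂ)
    (M : Matrix (Fin k × n) (Fin k × n) ℂ) : Matrix (Fin k × m) (Fin k × m) ℂ :=
  Matrix.of fun p q => Φ (Matrix.of fun a b => M (p.1, a) (q.1, b)) p.2 q.2

/-- Complete positivity: every `id_k ⊗ Φ` preserves positive semidefiniteness. -/
def IsCompletelyPositive {n m : Type} (Φ : Matrix n n ℂ →ₗ[ℂ] Matrix m m ℂ) : Prop :=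
  ∀ (k : ℕ) (M : Matrix (Fin k × n) (Fin k × n) ℂ),
    M.PosSemidef → (ampliation k Φ M).PosSemidef

/-- A quantum channel: a completely positive, trace-preserving linear map. -/
structure IsChannel {n m : Type} [Fintype n] [Fintype m]
    (Φ : Matrix n n ℂ →ₗ[ℂ] Matrix m m ℂ) : Prop where
  completelyPositive : IsCompletelyPositive Φ
  tracePreserving : ∀ ρ : Matrix n n ℂ, (Φ ρ).trace = ρ.trace

/-- Partial trace over the second tensor factor. -/
def partialTraceRight {b e : Type} [Fintype e] (X : Matrix (b × e) (b × e) ℂ) : Matrix b b ℂ :=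
  Matrix.of fun i j => ∑ k, X (i, k) (j, k)

/-- Partial trace over the first tensor factor. -/
def partialTraceLeft {b e : Type} [Fintype b] (X : Matrix (b × e) (b × e) ℂ) : Matrix e e ℂ :=
  Matrix.of fun k l => ∑ i, X (i, k) (i, l)

/-- `Φc` is a complementary channel of `Φ`: for some isometry `W : A → B ⊗ E` one has
`Φ ρ = Tr_E (W ρ W†)` and `Φc ρ = Tr_B (W ρ W†)`. -/
def IsComplementary {a b e : Type} [Fintype a] [DecidableEq a] [Fintype b] [Fintype e]
    (Φ : Matrix a a ℂ →ₗ[ℂ] Matrix b b ℂ) (Φc : Matrix a a ℂ →ₗ[ℂ] Matrix e e ℂ) : Prop :=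
  ∃ W : Matrix (b × e) a ℂ, Wᴴ * W = 1 ∧
    (∀ ρ, Φ ρ = partialTraceRight (W * ρ * Wᴴ)) ∧
    (∀ ρ, Φc ρ = partialTraceLeft (W * ρ * Wᴴ))

/-- `Φ` is degradable: `Ψ ∘ Φ = Φᶜ` for some channel `Ψ`. -/
def IsDegradable {a b : Type} [Fintype a] [DecidableEq a] [Fintype b]
    (Φ : Matrix a a ℂ →ₗ[ℂ] Matrix b b ℂ) : Prop :=
  ∃ (d : ℕ) (Φc : Matrix a a ℂ →ₗ[ℂ] Matrix (Fin d) (Fin d) ℂ)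
    (Ψ : Matrix b b ℂ →ₗ[ℂ] Matrix (Fin d) (Fin d) ℂ),
    IsComplementary Φ Φc ∧ IsChannel Ψ ∧ Ψ ∘ₗ Φ = Φc

/-- `Φ` is anti-degradable: `Ψ ∘ Φᶜ = Φ` for some channel `Ψ`. -/
def IsAntiDegradable {a b : Type} [Fintype a] [DecidableEq a] [Fintype b]
    (Φ : Matrix a a ℂ →ₗ[ℂ] Matrix b b ℂ) : Prop :=
  ∃ (d : ℕ) (Φc : Matrix a a ℂ →ₗ[ℂ] Matrix (Fin d) (Fin d) ℂ)
    (Ψ : Matrix (Fin d) (Fin d) ℂ →ₗ[ℂ] Matrix b b ℂ),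
    IsComplementary Φ Φc ∧ IsChannel Ψ ∧ Ψ ∘ₗ Φc = Φ

/-- The Choi rank: the rank of `∑ i j, |i⟩⟨j| ⊗ Φ(|i⟩⟨j|)` (the normalisation of the maximally
entangled state does not change the rank). -/
def choiRank {a b : Type} [Fintype a] [DecidableEq a] [Fintype b]
    (Φ : Matrix a a ℂ →ₗ[ℂ] Matrix b b ℂ) : ℕ :=
  (Matrix.of fun p q : a × b => Φ (Matrix.single p.1 q.1 1) p.2 q.2).rank

/-- Linear maps on `M_2`. -/
abbrev QubitMap : Type := Matrix (Fin 2) (Fin 2) ℂ →ₗ[ℂ] Matrix (Fin 2) (Fin 2) ℂ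

/-- `Φ` equals `Φ'` up to unitary conjugations on the input and on the output. -/
def UnitarilyEquivalent (Φ Φ' : QubitMap) : Prop :=
  ∃ U ∈ Matrix.unitaryGroup (Fin 2) ℂ, ∃ V ∈ Matrix.unitaryGroup (Fin 2) ℂ,
    ∀ ρ, Φ ρ = U * Φ' (V * ρ * Vᴴ) * Uᴴ

def pauliX : Matrix (Fin 2) (Fin 2) ℂ := !![0, 1; 1, 0]

def pauliY : Matrix (Fin 2) (Fin 2) ℂ := !![0, -Complex.I; Complex.I, 0]

def pauliZ : Matrix (Fin 2) (Fin 2) ℂ := !![1, 0; 0, -1]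

/-- The Kraus operator `A₊ = cos(v/2) cos(u/2) I + sin(v/2) sin(u/2) σ_z`. -/
def krausPlus (u v : ℝ) : Matrix (Fin 2) (Fin 2) ℂ :=
  ((Real.cos (v / 2) * Real.cos (u / 2) : ℝ) : ℂ) • (1 : Matrix (Fin 2) (Fin 2) ℂ)
    + ((Real.sin (v / 2) * Real.sin (u / 2) : ℝ) : ℂ) • pauliZ

/-- The Kraus operator `A₋ = sin(v/2) cos(u/2) σ_x + i cos(v/2) sin(u/2) σ_y`. -/
def krausMinus (u v : ℝ) : Matrix (Fin 2) (Fin 2) ℂ :=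
  ((Real.sin (v / 2) * Real.cos (u / 2) : ℝ) : ℂ) • pauliX
    + (Complex.I * ((Real.cos (v / 2) * Real.sin (u / 2) : ℝ) : ℂ)) • pauliY

theorem krausPlus_eq (u v : ℝ) :
    krausPlus u v =
      !![((Real.cos ((v - u) / 2) : ℝ) : ℂ), 0; 0, ((Real.cos ((u + v) / 2) : ℝ) : ℂ)] := by
  have h1 : (v - u) / 2 = v / 2 - u / 2 := by ring
  have h2 : (u + v) / 2 = u / 2 + v / 2 := by ring
  rw [h1, h2, Real.cos_sub, Real.cos_add]
  ext i j
  fin_cases i <;> fin_cases j <;> simp [krausPlus, pauliZ] <;> ring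

theorem krausMinus_eq (u v : ℝ) :
    krausMinus u v =
      !![0, ((Real.sin ((u + v) / 2) : ℝ) : ℂ); ((Real.sin ((v - u) / 2) : ℝ) : ℂ), 0] := by
  have h1 : (v - u) / 2 = v / 2 - u / 2 := by ring
  have h2 : (u + v) / 2 = u / 2 + v / 2 := by ring
  have hI : ∀ z : ℂ, Complex.I * z * Complex.I = -z := by
    intro z
    linear_combination z * Complex.I_mul_I
  rw [h1, h2, Real.sin_sub, Real.sin_add]
  ext i j
  fin_cases i <;> fin_cases j <;> simp [krausMinus, pauliX, pauliY, hI] <;> ring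

/-- The map `ρ ↦ A₊ ρ A₊† + A₋ ρ A₋†`. -/
def krausChannel (u v : ℝ) : QubitMap where
  toFun ρ := krausPlus u v * ρ * (krausPlus u v)ᴴ + krausMinus u v * ρ * (krausMinus u v)ᴴ
  map_add' x y := by simp only [mul_add, add_mul]; abel
  map_smul' c x := by simp

/-- The map `Φ(u,v)` given on `ρ = ½ (w₀ I + w₁ σ_x + w₂ σ_y + w₃ σ_z)`, where `w_k = Tr σ_k ρ`, by
`½ (w₀ I + cos u w₁ σ_x + cos v w₂ σ_y + (sin u sin v w₀ + cos u cos v w₃) σ_z)`. -/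
def blochChannel (u v : ℝ) : QubitMap where
  toFun ρ := (1 / 2 : ℂ) • (ρ.trace • (1 : Matrix (Fin 2) (Fin 2) ℂ)
    + (((Real.cos u : ℝ) : ℂ) * (pauliX * ρ).trace) • pauliX
    + (((Real.cos v : ℝ) : ℂ) * (pauliY * ρ).trace) • pauliY
    + (((Real.sin u * Real.sin v : ℝ) : ℂ) * ρ.trace
        + ((Real.cos u * Real.cos v : ℝ) : ℂ) * (pauliZ * ρ).trace) • pauliZ)
  map_add' x y := by
    simp only [Matrix.trace_add, mul_add]
    module
  map_smul' c x := by
    simp only [Matrix.trace_smul, Matrix.mul_smul, smul_eq_mul, RingHom.id_apply]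
    module

end

/-! The core is a normal form: every isometry W : ℂ² → ℂ² ⊗ ℂ² equals (U ⊗ Z) K V with U, Z, V
unitary and K = `krausIsometry u v` (`exists_krausIsometry_normal_form`). Reshape the columns of W
into a Hilbert–Schmidt orthonormal pair M, N of 2 × 2 matrices. A unitary mixing of the pair, which
is V, also makes it orthogonal for the polarised determinant tr(adj(M) N). Once U and Z make M
diagonal, the two orthogonality relations force N to be off-diagonal (in the degenerate case of
equal singular values, after one more rotation). Phases are absorbed, and two angles remain.

A degradable channel comes with an environment of arbitrary dimension, but a qubit suffices
(`exists_environment_projection`). If some Φ(|a⟩⟨a|) is invertible, a positive functional ⟨z, Ψ(·)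
z⟩ vanishing on it vanishes on all outputs, so the support of Φᶜ(|a⟩⟨a|), of dimension at most two,
contains every environment vector. Otherwise each basis input gives a pure output and contributes
one environment direction.

In normal form, degrading yields a positive map that does not increase the trace and sends cos u σ_x
to sin v σ_x. Such maps contract σ_x, so |sin v| ≤ |cos u|. Conversely, under this bound, Φ(θ₁,θ₂) ∘
Φ(u,v) is the complement Φ(v - π/2, u - π/2) (`blochChannel_degrading`). Anti-degradability follows
by degrading the complement, because the double complement is Φ(u,v) up to σ_z. For the Choi rank,
A₊ and A₋ are orthogonal with square norms 1 ± cos u cos v. -/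

open scoped Kronecker

noncomputable section

/-! ### Completely positive maps -/

/-- The map `ρ ↦ A ρ Aᴴ`. -/
def conjMap {n m : Type} [Fintype n] (A : Matrix m n ℂ) : Matrix n n ℂ →ₗ[ℂ] Matrix m m ℂ where
  toFun ρ := A * ρ * Aᴴ
  map_add' x y := by simp only [Matrix.mul_add, Matrix.add_mul]
  map_smul' c x := by simp

theorem conjMap_apply {n m : Type} [Fintype n] (A : Matrix m n ℂ) (ρ : Matrix n n ℂ) :
    conjMap A ρ = A * ρ * Aᴴ := rfl

theorem ampliation_conjMap {n m : Type} [Fintype n] (k : ℕ) (A : Matrix m n ℂ)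
    (M : Matrix (Fin k × n) (Fin k × n) ℂ) :
    ampliation k (conjMap A) M
      = ((1 : Matrix (Fin k) (Fin k) ℂ) ⊗ₖ A) * M * ((1 : Matrix (Fin k) (Fin k) ℂ) ⊗ₖ A)ᴴ := by
  ext ⟨i, a⟩ ⟨j, b⟩
  simp [ampliation, conjMap_apply, Matrix.mul_apply, Fintype.sum_prod_type, Matrix.one_apply,
    Matrix.conjTranspose_apply, Matrix.kroneckerMap_apply, ite_mul, Finset.sum_ite_eq, apply_ite]

theorem isCompletelyPositive_conjMap {n m : Type} [Fintype n] [Fintype m] (A : Matrix m n ℂ) :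
    IsCompletelyPositive (conjMap A) := by
  intro k M hM
  rw [ampliation_conjMap]
  exact hM.mul_mul_conjTranspose_same _

theorem IsCompletelyPositive.add {n m : Type} {Φ Ψ : Matrix n n ℂ →ₗ[ℂ] Matrix m m ℂ}
    (hΦ : IsCompletelyPositive Φ) (hΨ : IsCompletelyPositive Ψ) :
    IsCompletelyPositive (Φ + Ψ) := fun k M hM => (hΦ k M hM).add (hΨ k M hM)

theorem IsCompletelyPositive.comp {n m l : Type} {Φ : Matrix n n ℂ →ₗ[ℂ] Matrix m m ℂ}
    {Ψ : Matrix m m ℂ →ₗ[ℂ] Matrix l l ℂ}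
    (hΨ : IsCompletelyPositive Ψ) (hΦ : IsCompletelyPositive Φ) :
    IsCompletelyPositive (Ψ ∘ₗ Φ) := fun k M hM => hΨ k _ (hΦ k M hM)

theorem IsCompletelyPositive.posSemidef {n m : Type} {Φ : Matrix n n ℂ →ₗ[ℂ] Matrix m m ℂ}
    (hΦ : IsCompletelyPositive Φ) {ρ : Matrix n n ℂ} (hρ : ρ.PosSemidef) : (Φ ρ).PosSemidef :=
  (hΦ 1 (ρ.submatrix Prod.snd Prod.snd) (hρ.submatrix _)).submatrix fun i => ((0 : Fin 1), i)

theorem IsChannel.comp {n m l : Type} [Fintype n] [Fintype m] [Fintype l]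
    {Φ : Matrix n n ℂ →ₗ[ℂ] Matrix m m ℂ} {Ψ : Matrix m m ℂ →ₗ[ℂ] Matrix l l ℂ}
    (hΨ : IsChannel Ψ) (hΦ : IsChannel Φ) : IsChannel (Ψ ∘ₗ Φ) where
  completelyPositive := hΨ.completelyPositive.comp hΦ.completelyPositive
  tracePreserving ρ := (hΨ.tracePreserving _).trans (hΦ.tracePreserving ρ)

theorem isChannel_conjMap {n m : Type} [Fintype n] [DecidableEq n] [Fintype m] {A : Matrix m n ℂ}
    (hA : Aᴴ * A = 1) : IsChannel (conjMap A) where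
  completelyPositive := isCompletelyPositive_conjMap A
  tracePreserving ρ := by
    rw [conjMap_apply, Matrix.trace_mul_comm, ← Matrix.mul_assoc, hA, Matrix.one_mul]

/-! ### Partial traces -/

theorem partialTraceRight_kronecker_conj {b b' e e' : Type} [Fintype b] [Fintype e] [Fintype e']
    [DecidableEq e] (U : Matrix b' b ℂ) {Z : Matrix e' e ℂ} (hZ : Zᴴ * Z = 1)
    (X : Matrix (b × e) (b × e) ℂ) :
    partialTraceRight ((U ⊗ₖ Z) * X * (U ⊗ₖ Z)ᴴ) = U * partialTraceRight X * Uᴴ := by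
  have h : ∀ l l', ∑ k, Z k l * star (Z k l') = if l' = l then 1 else 0 := fun l l' => by
    rw [← Matrix.one_apply, ← hZ, Matrix.mul_apply]
    exact Finset.sum_congr rfl fun k _ => by rw [Matrix.conjTranspose_apply, mul_comm]
  ext i j
  simp only [partialTraceRight, Matrix.mul_apply, Matrix.of_apply, Matrix.conjTranspose_apply,
    Matrix.kroneckerMap_apply, Fintype.sum_prod_type, star_mul', Finset.sum_mul, Finset.mul_sum]
  rw [Finset.sum_comm]
  refine Finset.sum_congr rfl fun j' _ => ?_
  have h1 : ∀ x x_1 x_2 x_3, U i x_2 * Z x x_3 * X (x_2, x_3) (j', x_1) *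
      (star (U j j') * star (Z x x_1)) =
      (U i x_2 * X (x_2, x_3) (j', x_1) * star (U j j')) * (Z x x_3 * star (Z x x_1)) :=
    fun _ _ _ _ => by ring
  simp only [h1]
  rw [Finset.sum_comm]
  simp only [Finset.sum_comm (s := (Finset.univ : Finset e')), ← Finset.mul_sum, h]
  rw [Finset.sum_comm]
  simp

theorem partialTraceLeft_kronecker_conj {b b' e e' : Type} [Fintype b] [Fintype b'] [Fintype e]
    [DecidableEq b] {U : Matrix b' b ℂ} (hU : Uᴴ * U = 1) (Z : Matrix e' e ℂ)
    (X : Matrix (b × e) (b × e) ℂ) :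
    partialTraceLeft ((U ⊗ₖ Z) * X * (U ⊗ₖ Z)ᴴ) = Z * partialTraceLeft X * Zᴴ := by
  have h := partialTraceRight_kronecker_conj Z hU (X.submatrix Prod.swap Prod.swap)
  have e1 : partialTraceRight (X.submatrix Prod.swap Prod.swap) = partialTraceLeft X := rfl
  rw [← e1, ← h]
  ext k l
  simp only [partialTraceLeft, partialTraceRight, Matrix.of_apply, Matrix.mul_apply,
    Matrix.submatrix_apply, Matrix.conjTranspose_apply, Matrix.kroneckerMap_apply, Prod.swap]
  refine Finset.sum_congr rfl fun i _ => ?_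
  rw [← (Equiv.prodComm e b).sum_comp]
  refine Finset.sum_congr rfl fun p _ => ?_
  rw [← (Equiv.prodComm e b).sum_comp]
  simp only [Equiv.prodComm_apply, Prod.swap, star_mul']
  rw [mul_comm (star (U _ _))]
  congr 1
  exact Finset.sum_congr rfl fun q _ => by rw [mul_comm (U _ _)]

/-! ### The dilation of `Φ(u,v)` -/

/-- In the coordinates x = (v - u)/2, y = (u + v)/2 the Kraus entries are plain sines and cosines,
so the identities below become polynomial ones modulo sin² + cos² = 1. -/
theorem exists_half_angles (u v : ℝ) : ∃ x y : ℝ, u = y - x ∧ v = y + x :=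
  ⟨(v - u) / 2, (u + v) / 2, by ring, by ring⟩

theorem krausPlus_half (x y : ℝ) :
    krausPlus (y - x) (y + x) = !![((Real.cos x : ℝ) : ℂ), 0; 0, ((Real.cos y : ℝ) : ℂ)] := by
  rw [krausPlus_eq]; congr! <;> ring

theorem krausMinus_half (x y : ℝ) :
    krausMinus (y - x) (y + x) = !![0, ((Real.sin y : ℝ) : ℂ); ((Real.sin x : ℝ) : ℂ), 0] := by
  rw [krausMinus_eq]; congr! <;> ring

/-- The isometry `A₊ ⊗ |0⟩ + A₋ ⊗ |1⟩`. -/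
def krausIsometry (u v : ℝ) : Matrix (Fin 2 × Fin 2) (Fin 2) ℂ :=
  Matrix.of fun p a => (![krausPlus u v, krausMinus u v] p.2) p.1 a

theorem ofReal_sin_sq_add_cos_sq (x : ℝ) :
    ((Real.sin x : ℝ) : ℂ) ^ 2 + ((Real.cos x : ℝ) : ℂ) ^ 2 = 1 := by
  exact_mod_cast congrArg ((↑) : ℝ → ℂ) (Real.sin_sq_add_cos_sq x)

theorem krausIsometry_isometry (u v : ℝ) : (krausIsometry u v)ᴴ * krausIsometry u v = 1 := by
  obtain ⟨x, y, rfl, rfl⟩ := exists_half_angles u v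
  have hx := ofReal_sin_sq_add_cos_sq x
  have hy := ofReal_sin_sq_add_cos_sq y
  ext i j
  fin_cases i <;> fin_cases j <;>
    simp [krausIsometry, krausPlus_half, krausMinus_half, Matrix.mul_apply,
      Fintype.sum_prod_type, -Complex.ofReal_cos, -Complex.ofReal_sin]
  · linear_combination hx
  · linear_combination hy

theorem partialTraceRight_krausIsometry (u v : ℝ) (ρ : Matrix (Fin 2) (Fin 2) ℂ) :
    partialTraceRight (krausIsometry u v * ρ * (krausIsometry u v)ᴴ) = krausChannel u v ρ := by
  ext i j
  simp [partialTraceRight, krausIsometry, krausChannel, Matrix.mul_apply]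

theorem Matrix.conjTranspose_fin_two_of (a b c d : ℂ) :
    !![a, b; c, d]ᴴ = !![star a, star c; star b, star d] := by
  ext i j
  fin_cases i <;> fin_cases j <;> rfl

theorem blochChannel_fin_two (u v : ℝ) (a b c d : ℂ) :
    blochChannel u v !![a, b; c, d] =
      !![((a + d) + (((Real.sin u : ℝ) : ℂ) * ((Real.sin v : ℝ) : ℂ)) * (a + d)
          + (((Real.cos u : ℝ) : ℂ) * ((Real.cos v : ℝ) : ℂ)) * (a - d)) / 2,
        (((Real.cos u : ℝ) : ℂ) * (b + c) + ((Real.cos v : ℝ) : ℂ) * (b - c)) / 2;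
        (((Real.cos u : ℝ) : ℂ) * (b + c) - ((Real.cos v : ℝ) : ℂ) * (b - c)) / 2,
        ((a + d) - (((Real.sin u : ℝ) : ℂ) * ((Real.sin v : ℝ) : ℂ)) * (a + d)
          - (((Real.cos u : ℝ) : ℂ) * ((Real.cos v : ℝ) : ℂ)) * (a - d)) / 2] := by
  have hI := Complex.I_mul_I
  ext i j
  fin_cases i <;> fin_cases j <;>
    simp [blochChannel, pauliX, pauliY, pauliZ, Matrix.trace_fin_two,
      -Complex.ofReal_cos, -Complex.ofReal_sin]
  · ring
  · linear_combination (-((Real.cos v : ℝ) : ℂ) * (b - c) / 2) * hI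
  · linear_combination (((Real.cos v : ℝ) : ℂ) * (b - c) / 2) * hI
  · ring

theorem partialTraceLeft_krausIsometry (u v : ℝ) (ρ : Matrix (Fin 2) (Fin 2) ℂ) :
    partialTraceLeft (krausIsometry u v * ρ * (krausIsometry u v)ᴴ)
      = blochChannel (v - Real.pi / 2) (u - Real.pi / 2) ρ := by
  obtain ⟨x, y, rfl, rfl⟩ := exists_half_angles u v
  have hx := ofReal_sin_sq_add_cos_sq x
  have hy := ofReal_sin_sq_add_cos_sq y
  rw [Matrix.eta_fin_two ρ, blochChannel_fin_two]
  simp only [Real.cos_add, Real.cos_sub,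
    Real.sin_add, Real.sin_sub, Complex.ofReal_add, Complex.ofReal_sub, Complex.ofReal_mul]
  generalize ρ 0 0 = a, ρ 0 1 = b, ρ 1 0 = c, ρ 1 1 = d
  ext i j
  fin_cases i <;> fin_cases j <;>
    simp [partialTraceLeft, krausIsometry, krausPlus_half, krausMinus_half, Matrix.mul_apply,
      Fin.sum_univ_two, -Complex.ofReal_cos, -Complex.ofReal_sin]
  all_goals generalize ((Real.sin x : ℝ) : ℂ) = sx, ((Real.cos x : ℝ) : ℂ) = cx,
    ((Real.sin y : ℝ) : ℂ) = sy, ((Real.cos y : ℝ) : ℂ) = cy at *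
  · grind
  · ring
  · ring
  · grind

theorem krausChannel_eq_blochChannel (u v : ℝ) : krausChannel u v = blochChannel u v := by
  obtain ⟨x, y, rfl, rfl⟩ := exists_half_angles u v
  have hx := ofReal_sin_sq_add_cos_sq x
  have hy := ofReal_sin_sq_add_cos_sq y
  refine LinearMap.ext fun ρ => ?_
  rw [Matrix.eta_fin_two ρ, blochChannel_fin_two]
  simp only [Real.cos_add, Real.cos_sub,
    Real.sin_add, Real.sin_sub, Complex.ofReal_add, Complex.ofReal_sub, Complex.ofReal_mul]
  generalize ρ 0 0 = a, ρ 0 1 = b, ρ 1 0 = c, ρ 1 1 = d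
  ext i j
  fin_cases i <;> fin_cases j <;>
    simp [krausChannel, krausPlus_half, krausMinus_half, Matrix.conjTranspose_fin_two_of,
      -Complex.ofReal_cos, -Complex.ofReal_sin]
  all_goals generalize ((Real.sin x : ℝ) : ℂ) = sx, ((Real.cos x : ℝ) : ℂ) = cx,
    ((Real.sin y : ℝ) : ℂ) = sy, ((Real.cos y : ℝ) : ℂ) = cy at *
  · grind
  · ring
  · ring
  · grind

theorem isChannel_krausChannel (u v : ℝ) : IsChannel (krausChannel u v) where
  completelyPositive := by
    have h : krausChannel u v = conjMap (krausPlus u v) + conjMap (krausMinus u v) :=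
      LinearMap.ext fun ρ => rfl
    rw [h]
    exact (isCompletelyPositive_conjMap _).add (isCompletelyPositive_conjMap _)
  tracePreserving ρ := by
    have h : (krausChannel u v ρ).trace
        = (krausIsometry u v * ρ * (krausIsometry u v)ᴴ).trace := by
      rw [← partialTraceRight_krausIsometry]
      simp [Matrix.trace, partialTraceRight, Fintype.sum_prod_type]
    rw [h, Matrix.trace_mul_comm, ← Matrix.mul_assoc, krausIsometry_isometry, Matrix.one_mul]

theorem isComplementary_blochChannel (u v : ℝ) : IsComplementary (blochChannel u v)
    (blochChannel (v - Real.pi / 2) (u - Real.pi / 2)) :=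
  ⟨krausIsometry u v, krausIsometry_isometry u v,
    fun ρ => by rw [partialTraceRight_krausIsometry, krausChannel_eq_blochChannel],
    fun ρ => (partialTraceLeft_krausIsometry u v ρ).symm⟩

/-! ### The degrading map -/

/-- On Bloch vectors the σ_z scaling is the product of the other two, so it follows from `hx` and
`hy`; only the translation needs its own condition. -/
theorem blochChannel_comp (t₁ t₂ u v s₁ s₂ : ℝ)
    (hx : Real.cos t₁ * Real.cos u = Real.cos s₁) (hy : Real.cos t₂ * Real.cos v = Real.cos s₂)
    (hz : Real.sin t₁ * Real.sin t₂ + Real.cos t₁ * Real.cos t₂ * (Real.sin u * Real.sin v)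
      = Real.sin s₁ * Real.sin s₂) :
    blochChannel t₁ t₂ ∘ₗ blochChannel u v = blochChannel s₁ s₂ := by
  refine LinearMap.ext fun ρ => ?_
  have hx' := congrArg ((↑) : ℝ → ℂ) hx
  have hy' := congrArg ((↑) : ℝ → ℂ) hy
  have hz' := congrArg ((↑) : ℝ → ℂ) hz
  push_cast [-Complex.ofReal_cos, -Complex.ofReal_sin] at hx' hy' hz'
  rw [LinearMap.comp_apply, Matrix.eta_fin_two ρ, blochChannel_fin_two, blochChannel_fin_two,
    blochChannel_fin_two]
  generalize ρ 0 0 = a, ρ 0 1 = b, ρ 1 0 = c, ρ 1 1 = d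
  rw [← hx', ← hy', ← hz']
  ext i j
  fin_cases i <;> fin_cases j <;> simp [-Complex.ofReal_cos, -Complex.ofReal_sin] <;> ring

theorem blochChannel_degrading {u v θ₁ θ₂ : ℝ} (huv : |Real.sin v| ≤ |Real.cos u|)
    (h₁ : Real.cos u * Real.cos θ₁ = Real.sin v) (h₂ : Real.cos v * Real.cos θ₂ = Real.sin u)
    (h₃ : 0 ≤ (Real.cos u * Real.cos v) * (Real.sin θ₁ * Real.sin θ₂)) :
    blochChannel θ₁ θ₂ ∘ₗ blochChannel u v =
      blochChannel (v - Real.pi / 2) (u - Real.pi / 2) := by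
  have hu := Real.sin_sq_add_cos_sq u
  have hv := Real.sin_sq_add_cos_sq v
  have ht1 := Real.sin_sq_add_cos_sq θ₁
  have ht2 := Real.sin_sq_add_cos_sq θ₂
  have hsq : Real.sin v ^ 2 ≤ Real.cos u ^ 2 := sq_le_sq.2 huv
  apply blochChannel_comp
  · rw [Real.cos_sub_pi_div_two]; linarith
  · rw [Real.cos_sub_pi_div_two]; linarith
  rw [Real.sin_sub_pi_div_two, Real.sin_sub_pi_div_two]
  -- The translation condition is proved after multiplication by cos u cos v. If this factor is
  -- zero, say cos u = 0, then sin v = 0, hence cos θ₂ = ±1 and sin θ₂ = 0, so both sides vanish.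
  rcases eq_or_ne (Real.cos u * Real.cos v) 0 with h0 | h0
  · have hS : Real.sin v * Real.sin u = 0 ∧ Real.sin θ₁ * Real.sin θ₂ = 0 := by
      rcases mul_eq_zero.1 h0 with h | h
      · have hv0 : Real.sin v = 0 := by rw [← h₁, h, zero_mul]
        have hS2 : Real.sin θ₂ ^ 2 = 0 := by
          rw [← h₂] at hu
          rw [h] at hu
          rw [hv0] at hv
          linear_combination ht2 - hu + Real.cos θ₂ ^ 2 * hv
        rw [hv0, pow_eq_zero_iff two_ne_zero |>.1 hS2]
        simp
      · have hu0 : Real.sin u = 0 := by rw [← h₂, h, zero_mul]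
        have hS1 : Real.sin θ₁ ^ 2 = 0 := by
          rw [← h₁] at hv
          rw [h] at hv
          rw [hu0] at hu
          linear_combination ht1 - hv + Real.cos θ₁ ^ 2 * hu
        rw [hu0, pow_eq_zero_iff two_ne_zero |>.1 hS1]
        simp
    linear_combination hS.2 + Real.cos θ₁ * Real.cos θ₂ * hS.1 - h0
  · have hD : (Real.cos u * Real.cos v) * (Real.sin θ₁ * Real.sin θ₂)
        = Real.cos u ^ 2 - Real.sin v ^ 2 := by
      -- Only the squares are determined by `h₁` and `h₂`; the sign hypothesis `h₃` selects the
      -- root.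
      refine (sq_eq_sq₀ h₃ (by linarith)).1 ?_
      have e1 : Real.cos u ^ 2 * Real.sin θ₁ ^ 2 = Real.cos u ^ 2 - Real.sin v ^ 2 := by
        rw [← h₁]; linear_combination Real.cos u ^ 2 * ht1
      have e2 : Real.cos v ^ 2 * Real.sin θ₂ ^ 2 = Real.cos u ^ 2 - Real.sin v ^ 2 := by
        have : Real.cos v ^ 2 * Real.sin θ₂ ^ 2 = Real.cos v ^ 2 - Real.sin u ^ 2 := by
          rw [← h₂]; linear_combination Real.cos v ^ 2 * ht2
        linarith
      calc _ = (Real.cos u ^ 2 * Real.sin θ₁ ^ 2) * (Real.cos v ^ 2 * Real.sin θ₂ ^ 2) := by ring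
        _ = _ := by rw [e1, e2]; ring
    refine mul_left_cancel₀ h0 ?_
    linear_combination hD + Real.sin u * Real.sin v * Real.cos u * Real.cos θ₁ * h₂
      + Real.sin u ^ 2 * Real.sin v * h₁ - Real.cos u ^ 2 * hv + Real.sin v ^ 2 * hu

theorem blochChannel_arccos_degrading {u v : ℝ} (huv : |Real.sin v| ≤ |Real.cos u|) :
    blochChannel
        ((if Real.cos u * Real.cos v < 0 then -1 else 1) *
          Real.arccos (Real.sin v / Real.cos u))
        (Real.arccos (Real.sin u / Real.cos v)) ∘ₗ blochChannel u v =
      blochChannel (v - Real.pi / 2) (u - Real.pi / 2) := by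
  -- For c = 0 the bound forces s = 0, so the value of s / c does not matter.
  have key : ∀ c s : ℝ, |s| ≤ |c| → c * Real.cos (Real.arccos (s / c)) = s := by
    intro c s h
    rcases eq_or_ne c 0 with rfl | hc
    · have : s = 0 := by simpa using h
      simp [this]
    · have := abs_le.1 ((abs_div s c).trans_le (div_le_one_of_le₀ h (abs_nonneg c)))
      rw [Real.cos_arccos this.1 this.2, mul_div_cancel₀ _ hc]
  have huv' : |Real.sin u| ≤ |Real.cos v| := by
    rw [← sq_le_sq] at huv ⊢
    linarith [Real.sin_sq_add_cos_sq u, Real.sin_sq_add_cos_sq v]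
  have hs1 := Real.sin_nonneg_of_nonneg_of_le_pi (Real.arccos_nonneg (Real.sin v / Real.cos u))
    (Real.arccos_le_pi _)
  have hs2 := Real.sin_nonneg_of_nonneg_of_le_pi (Real.arccos_nonneg (Real.sin u / Real.cos v))
    (Real.arccos_le_pi _)
  refine blochChannel_degrading huv ?_ (key _ _ huv') ?_
  · split_ifs <;> simp only [neg_mul, one_mul, Real.cos_neg] <;> exact key _ _ huv
  · split_ifs with h
    · simp only [neg_mul, one_mul, Real.sin_neg]
      nlinarith [mul_nonneg hs1 hs2]
    · simp only [one_mul]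
      exact mul_nonneg (not_lt.1 h) (mul_nonneg hs1 hs2)

/-! ### Unitary matrices of size two -/

/-- The unitary with first column `(x, y)`, for a unit vector `(x, y)`. -/
def columnUnitary (x y : ℂ) : Matrix (Fin 2) (Fin 2) ℂ := !![x, -star y; y, star x]

theorem columnUnitary_mem {x y : ℂ} (h : star x * x + star y * y = 1) :
    columnUnitary x y ∈ Matrix.unitaryGroup (Fin 2) ℂ := by
  rw [Matrix.mem_unitaryGroup_iff', columnUnitary, Matrix.star_eq_conjTranspose,
    Matrix.conjTranspose_fin_two_of, Matrix.mul_fin_two, Matrix.one_fin_two]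
  congr! 1
  simp only [star_neg, star_star]
  ext i j
  fin_cases i <;> fin_cases j <;> simp at h ⊢
  · linear_combination h
  · ring
  · ring
  · linear_combination h

theorem diagonal_mem_unitaryGroup {x y : ℂ} (hx : star x * x = 1) (hy : star y * y = 1) :
    !![x, 0; 0, y] ∈ Matrix.unitaryGroup (Fin 2) ℂ := by
  rw [Matrix.mem_unitaryGroup_iff', Matrix.star_eq_conjTranspose,
    Matrix.conjTranspose_fin_two_of, Matrix.mul_fin_two, Matrix.one_fin_two, hx, hy]
  simp

theorem exists_unit_multiple (x y : ℂ) (h : ¬(x = 0 ∧ y = 0)) : ∃ c : ℂ, c ≠ 0 ∧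
    star (c * x) * (c * x) + star (c * y) * (c * y) = 1 := by
  have hpos : 0 < Complex.normSq x + Complex.normSq y := by
    by_contra hn
    have hx := Complex.normSq_nonneg x
    have hy := Complex.normSq_nonneg y
    exact h ⟨Complex.normSq_eq_zero.1 (by linarith), Complex.normSq_eq_zero.1 (by linarith)⟩
  have hs := Real.sqrt_pos.2 hpos
  have hss := Real.mul_self_sqrt hpos.le
  set s := √(Complex.normSq x + Complex.normSq y)
  have hs0 : (s : ℂ) ≠ 0 := by exact_mod_cast hs.ne'
  refine ⟨(s : ℂ)⁻¹, inv_ne_zero hs0, ?_⟩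
  have hss' : (s : ℂ) * s = star x * x + star y * y := by
    have := congrArg ((↑) : ℝ → ℂ) hss
    push_cast [Complex.normSq_eq_conj_mul_self] at this
    exact this
  simp only [star_mul', star_inv₀, Complex.star_def, Complex.conj_ofReal] at hss' ⊢
  field_simp
  linear_combination -hss'

theorem exists_unit_orthogonal (x y : ℂ) : ∃ z w : ℂ, star z * z + star w * w = 1 ∧
    star z * x + star w * y = 0 := by
  by_cases h : x = 0 ∧ y = 0
  · exact ⟨1, 0, by simp, by simp [h.1, h.2]⟩
  · obtain ⟨c, -, hc⟩ := exists_unit_multiple (-star y) (star x) (by simpa [and_comm] using h)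
    refine ⟨_, _, hc, ?_⟩
    simp only [star_mul', star_neg, star_star]
    ring

/-- The left side is ⟨ξ, T ξ⟩ for the traceless matrix T = (p, q; r, -p) and ξ = (x, y): zero lies
in the numerical range of T. -/
theorem exists_unit_isotropic (p q r : ℂ) : ∃ x y : ℂ, star x * x + star y * y = 1 ∧
    p * (star x * x - star y * y) + q * (star x * y) + r * (x * star y) = 0 := by
  by_cases hp : p = 0
  · exact ⟨1, 0, by simp, by simp [hp]⟩
  suffices h : ∃ w : ℂ, p * (1 - star w * w) + q * w + r * star w = 0 by
    obtain ⟨w, hw⟩ := h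
    obtain ⟨c, -, hc⟩ := exists_unit_multiple 1 w (by simp)
    refine ⟨_, _, hc, ?_⟩
    simp only [star_mul', star_one]
    linear_combination (star c * c) * hw
  -- The imaginary part is a real linear functional of g ∈ ℝ², so it has a nonzero kernel. Along
  -- such a g the equation for w = s g is a real quadratic in s with positive discriminant.
  obtain ⟨g, hg, him⟩ : ∃ g : ℂ, g ≠ 0 ∧ (q / p * g + r / p * star g).im = 0 := by
    by_cases h : (q / p).re - (r / p).re = 0 ∧ (q / p).im + (r / p).im = 0
    · exact ⟨1, one_ne_zero, by simpa using h.2⟩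
    · refine ⟨⟨(q / p).re - (r / p).re, -((q / p).im + (r / p).im)⟩, fun h0 => h ?_, ?_⟩
      · have h1 := congrArg Complex.re h0
        have h2 := congrArg Complex.im h0
        simp only [Complex.zero_re, Complex.zero_im] at h1 h2
        exact ⟨h1, by linarith⟩
      · generalize q / p = q', r / p = r'
        simp only [Complex.add_im, Complex.mul_im, Complex.star_def, Complex.conj_re,
          Complex.conj_im]
        ring
  set m := (q / p * g + r / p * star g).re with hm
  have hmc : q / p * g + r / p * star g = m := Complex.ext rfl (by simpa using him)
  have hn := Complex.normSq_pos.2 hg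
  set n := Complex.normSq g with hnd
  have hnc : star g * g = n := Complex.normSq_eq_conj_mul_self.symm
  obtain ⟨s, hs⟩ : ∃ s : ℝ, 1 - s ^ 2 * n + s * m = 0 := by
    have hd : 0 ≤ m ^ 2 + 4 * n := by positivity
    refine ⟨(m + √(m ^ 2 + 4 * n)) / (2 * n), ?_⟩
    have := Real.sq_sqrt hd
    field_simp
    linear_combination -this
  refine ⟨s * g, ?_⟩
  have hsc := congrArg ((↑) : ℝ → ℂ) hs
  push_cast at hsc
  rw [← hmc, ← hnc] at hsc
  simp only [star_mul', Complex.star_def, Complex.conj_ofReal] at hsc ⊢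
  field_simp at hsc
  linear_combination hsc

/-! ### Simultaneous normal form of a pair of matrices -/

theorem exists_unitary_mul_diagonal {N : Matrix (Fin 2) (Fin 2) ℂ} (h : (Nᴴ * N) 0 1 = 0) :
    ∃ U ∈ Matrix.unitaryGroup (Fin 2) ℂ, ∃ a b : ℂ, U * N = !![a, 0; 0, b] := by
  rw [Matrix.mul_apply, Fin.sum_univ_two] at h
  simp only [Matrix.conjTranspose_apply] at h
  -- (x, y) is the normalised first column, or a unit vector orthogonal to the second column if the
  -- first is zero.
  obtain ⟨x, y, hxy, h1, h0⟩ : ∃ x y : ℂ, star x * x + star y * y = 1 ∧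
      star x * N 0 1 + star y * N 1 1 = 0 ∧ -y * N 0 0 + x * N 1 0 = 0 := by
    by_cases h0 : N 0 0 = 0 ∧ N 1 0 = 0
    · obtain ⟨x, y, hxy, h1⟩ := exists_unit_orthogonal (N 0 1) (N 1 1)
      exact ⟨x, y, hxy, h1, by simp [h0.1, h0.2]⟩
    · obtain ⟨c, -, hc⟩ := exists_unit_multiple _ _ h0
      refine ⟨_, _, hc, ?_, by ring⟩
      simp only [star_mul']
      linear_combination star c * h
  refine ⟨star (columnUnitary x y), Unitary.star_mem (columnUnitary_mem hxy),
    star x * N 0 0 + star y * N 1 0, -y * N 0 1 + x * N 1 1, ?_⟩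
  rw [Matrix.eta_fin_two N, columnUnitary, Matrix.star_eq_conjTranspose,
    Matrix.conjTranspose_fin_two_of, Matrix.mul_fin_two]
  simp only [star_neg, star_star, h1, h0, Matrix.of_apply, Matrix.cons_val', Matrix.cons_val_zero,
    Matrix.cons_val_one, Matrix.cons_val_fin_one]

/-- The Hilbert–Schmidt product of matrices of size two. -/
theorem trace_conjTranspose_mul_fin_two (M N : Matrix (Fin 2) (Fin 2) ℂ) : (Mᴴ * N).trace =
    star (M 0 0) * N 0 0 + star (M 1 0) * N 1 0 + star (M 0 1) * N 0 1 + star (M 1 1) * N 1 1 := by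
  simp [Matrix.trace_fin_two, Matrix.mul_apply, Fin.sum_univ_two]
  ring

/-- This symmetric bilinear form is the polarisation of 2 det. -/
theorem trace_adjugate_mul_fin_two (M N : Matrix (Fin 2) (Fin 2) ℂ) : (M.adjugate * N).trace =
    M 1 1 * N 0 0 - M 0 1 * N 1 0 - M 1 0 * N 0 1 + M 0 0 * N 1 1 := by
  rw [Matrix.adjugate_fin_two, Matrix.eta_fin_two N, Matrix.mul_fin_two, Matrix.trace_fin_two_of]
  simp
  ring

theorem trace_conjTranspose_mul_unitary {U Z : Matrix (Fin 2) (Fin 2) ℂ}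
    (hU : U ∈ Matrix.unitaryGroup (Fin 2) ℂ) (hZ : Z ∈ Matrix.unitaryGroup (Fin 2) ℂ)
    (M N : Matrix (Fin 2) (Fin 2) ℂ) :
    ((U * M * Z)ᴴ * (U * N * Z)).trace = (Mᴴ * N).trace := by
  rw [Matrix.mem_unitaryGroup_iff', Matrix.star_eq_conjTranspose] at hU
  rw [Matrix.mem_unitaryGroup_iff, Matrix.star_eq_conjTranspose] at hZ
  rw [← Matrix.mul_assoc, Matrix.trace_mul_comm, Matrix.conjTranspose_mul, Matrix.conjTranspose_mul]
  calc _ = ((Z * Zᴴ) * Mᴴ * (Uᴴ * U) * N).trace := by simp only [Matrix.mul_assoc]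
    _ = _ := by rw [hU, hZ]; simp

theorem trace_adjugate_mul_unitary (U Z M N : Matrix (Fin 2) (Fin 2) ℂ) :
    ((U * M * Z).adjugate * (U * N * Z)).trace = U.det * Z.det * (M.adjugate * N).trace := by
  rw [← Matrix.mul_assoc, Matrix.trace_mul_comm, Matrix.adjugate_mul_distrib,
    Matrix.adjugate_mul_distrib]
  calc _ = ((Z * Z.adjugate) * M.adjugate * (U.adjugate * U) * N).trace := by
        simp only [Matrix.mul_assoc]
    _ = _ := by
        rw [Matrix.mul_adjugate, Matrix.adjugate_mul]
        simp [smul_smul]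

/-- With M = diag(a, b), the hypotheses are two linear equations in the diagonal entries of N, with
determinant ±(|a|² - |b|²). -/
theorem exists_diagonal_offDiagonal {M N : Matrix (Fin 2) (Fin 2) ℂ}
    (hM : (Mᴴ * M).trace = 1) (hMN : (Mᴴ * N).trace = 0) (hadj : (M.adjugate * N).trace = 0) :
    ∃ U ∈ Matrix.unitaryGroup (Fin 2) ℂ, ∃ Z ∈ Matrix.unitaryGroup (Fin 2) ℂ, ∃ a b q r : ℂ,
      U * M * Z = !![a, 0; 0, b] ∧ U * N * Z = !![0, q; r, 0] := by
  obtain ⟨Z, hZ, hZ0⟩ : ∃ Z ∈ Matrix.unitaryGroup (Fin 2) ℂ, ((M * Z)ᴴ * (M * Z)) 0 1 = 0 := by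
    have hH : (Mᴴ * M).IsHermitian := Matrix.isHermitian_conjTranspose_mul_self M
    refine ⟨hH.eigenvectorUnitary, hH.eigenvectorUnitary.2, ?_⟩
    have h := hH.conjStarAlgAut_star_eigenvectorUnitary
    rw [Unitary.conjStarAlgAut_apply] at h
    have h01 := congrFun (congrFun h 0) 1
    simp only [Matrix.diagonal_apply_ne _ (zero_ne_one : (0 : Fin 2) ≠ 1)] at h01
    rw [← h01, Matrix.conjTranspose_mul]
    simp [Matrix.mul_assoc, Matrix.star_eq_conjTranspose]
  obtain ⟨U, hU, a, b, hab⟩ := exists_unitary_mul_diagonal hZ0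
  rw [← Matrix.mul_assoc] at hab
  rw [← trace_conjTranspose_mul_unitary hU hZ, hab, trace_conjTranspose_mul_fin_two] at hM hMN
  have hadj' := trace_adjugate_mul_unitary U Z M N
  rw [hadj, hab, trace_adjugate_mul_fin_two] at hadj'
  generalize hN' : U * N * Z = N' at *
  simp only [Matrix.of_apply, Matrix.cons_val', Matrix.cons_val_zero, Matrix.cons_val_one,
    Matrix.cons_val_fin_one, star_zero, zero_mul, add_zero, mul_zero, sub_zero] at hM hMN hadj'
  -- If |a| = |b|, the phase 2āb = b/a turns M into the scalar b. The transformed N is traceless,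
  -- and conjugation by a unitary whose first column is isotropic for it clears its diagonal while
  -- fixing the scalar.
  by_cases hd : star a * a = star b * b
  · have hb : 2 * (star b * b) = 1 := by linear_combination hM - hd
    have ha : 2 * (star a * a) = 1 := by linear_combination hM + hd
    obtain ⟨x, y, hxy, h0⟩ := exists_unit_isotropic (2 * star a * b * N' 0 0)
      (2 * star a * b * N' 0 1) (N' 1 0)
    have hQ := columnUnitary_mem hxy
    have hD : !![2 * star a * b, 0; 0, 1] ∈ Matrix.unitaryGroup (Fin 2) ℂ := by
      apply diagonal_mem_unitaryGroup
      · simp only [star_mul', star_star, star_ofNat]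
        linear_combination 2 * (star b * b) * ha + hb
      · simp
    refine ⟨star (columnUnitary x y) * (!![2 * star a * b, 0; 0, 1] * U),
      mul_mem (Unitary.star_mem hQ) (mul_mem hD hU), Z * columnUnitary x y, mul_mem hZ hQ,
      b, b, ?_⟩
    have e1 : ∀ K, star (columnUnitary x y) * (!![2 * star a * b, 0; 0, 1] * U) * K
        * (Z * columnUnitary x y) = star (columnUnitary x y) *
          (!![2 * star a * b, 0; 0, 1] * (U * K * Z)) * columnUnitary x y := fun K => by
      simp only [Matrix.mul_assoc]
    rw [e1, e1, hab, hN']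
    have e2 : !![2 * star a * b, 0; 0, 1] * !![a, 0; 0, b] = b • (1 : Matrix (Fin 2) (Fin 2) ℂ) := by
      rw [Matrix.mul_fin_two, Matrix.one_fin_two]
      ext i j
      fin_cases i <;> fin_cases j <;> simp at ha ⊢
      linear_combination b * ha
    have hoff : ∃ q r, star (columnUnitary x y) * (!![2 * star a * b, 0; 0, 1] * N')
        * columnUnitary x y = !![0, q; r, 0] := by
      have hs : N' 1 1 = -(2 * star a * b * N' 0 0) := by
        linear_combination 2 * b * hMN - N' 1 1 * hb
      rw [Matrix.eta_fin_two N', hs, columnUnitary, Matrix.star_eq_conjTranspose,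
        Matrix.conjTranspose_fin_two_of, Matrix.mul_fin_two, Matrix.mul_fin_two,
        Matrix.mul_fin_two]
      simp only [star_neg, star_star, zero_mul, add_zero, zero_add, one_mul]
      generalize N' 0 0 = k, N' 0 1 = l, N' 1 0 = m at *
      have z0 : ((star x * (2 * star a * b * k) + star y * m) * x
          + (star x * (2 * star a * b * l) + star y * -(2 * star a * b * k)) * y) = 0 := by
        linear_combination h0
      have z1 : ((-y * (2 * star a * b * k) + x * m) * -star y
          + (-y * (2 * star a * b * l) + x * -(2 * star a * b * k)) * star x) = 0 := by
        linear_combination -h0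
      rw [z0, z1]
      exact ⟨_, _, rfl⟩
    obtain ⟨q, r, hqr⟩ := hoff
    refine ⟨q, r, ?_, hqr⟩
    rw [e2, Matrix.mul_smul, Matrix.smul_mul, Matrix.mul_one,
      Matrix.mem_unitaryGroup_iff'.1 hQ, Matrix.one_fin_two]
    simp
  · have hd' := sub_ne_zero.2 hd
    have h0 : N' 0 0 = 0 := by
      refine (mul_eq_zero.1 ?_).resolve_left hd'
      linear_combination a * hMN - star b * hadj'
    have h1 : N' 1 1 = 0 := by
      refine (mul_eq_zero.1 ?_).resolve_left hd'
      linear_combination star a * hadj' - b * hMN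
    refine ⟨U, hU, Z, hZ, a, b, N' 0 1, N' 1 0, hab, ?_⟩
    rw [hN', Matrix.eta_fin_two N', h0, h1]
    simp

theorem star_exp_mul_I_mul_self (t : ℝ) :
    star (Complex.exp (t * Complex.I)) * Complex.exp (t * Complex.I) = 1 := by
  rw [Complex.star_def, ← Complex.normSq_eq_conj_mul_self, Complex.normSq_eq_norm_sq,
    Complex.norm_exp_ofReal_mul_I]
  simp

theorem exists_angle {z w : ℂ} (h : star z * z + star w * w = 1) :
    ∃ x : ℝ, ‖z‖ = Real.cos x ∧ ‖w‖ = Real.sin x := by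
  have h' : ‖z‖ ^ 2 + ‖w‖ ^ 2 = 1 := by
    rw [Complex.star_def, ← Complex.normSq_eq_conj_mul_self,
      ← Complex.normSq_eq_conj_mul_self, Complex.normSq_eq_norm_sq, Complex.normSq_eq_norm_sq] at h
    exact_mod_cast h
  have hz := norm_nonneg z
  have hw := norm_nonneg w
  refine ⟨Real.arccos ‖z‖, (Real.cos_arccos (by linarith) (by nlinarith)).symm, ?_⟩
  rw [Real.sin_arccos, eq_comm, Real.sqrt_eq_iff_mul_self_eq (by nlinarith) hw]
  linarith

theorem exists_real_diagonal_offDiagonal {a b q r : ℂ} (hab : star a * a + star b * b = 1)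
    (hqr : star r * r + star q * q = 1) :
    ∃ U ∈ Matrix.unitaryGroup (Fin 2) ℂ, ∃ Z ∈ Matrix.unitaryGroup (Fin 2) ℂ, ∃ e : ℂ,
      star e * e = 1 ∧ ∃ x y : ℝ,
      U * !![a, 0; 0, b] * Z = !![((Real.cos x : ℝ) : ℂ), 0; 0, ((Real.sin x : ℝ) : ℂ)] ∧
      U * (e • !![0, q; r, 0]) * Z
        = !![0, ((Real.sin y : ℝ) : ℂ); ((Real.cos y : ℝ) : ℂ), 0] := by
  obtain ⟨x, hx1, hx2⟩ := exists_angle hab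
  obtain ⟨y, hy1, hy2⟩ := exists_angle hqr
  set E : ℝ → ℂ := fun t => Complex.exp (t * Complex.I) with hE
  have hE1 : ∀ t, star (E t) * E t = 1 := star_exp_mul_I_mul_self
  have hpolar : ∀ z : ℂ, z = ‖z‖ * E z.arg := fun z => (Complex.norm_mul_exp_arg_mul_I z).symm
  have hE0 : ∀ s t u v : ℝ, s + t + u + v = 0 → E s * E t * E u * E v = 1 := by
    intro s t u v h
    simp only [hE, ← Complex.exp_add]
    rw [← Complex.exp_zero]
    congr 1
    have := congrArg ((↑) : ℝ → ℂ) h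
    push_cast at this
    linear_combination Complex.I * this
  have hz : E 0 = 1 := by simp [hE]
  -- Row and column phases preserve arg a + arg b - arg q - arg r, so the scalar e must bring this
  -- to zero; it multiplies both q and r, hence the factor 1/2.
  set n := (a.arg + b.arg - q.arg - r.arg) / 2 with hn
  have ha := hE0 a.arg (-a.arg) 0 0 (by ring)
  have hb := hE0 b.arg (-r.arg - n + a.arg) (-q.arg - n) 0 (by rw [hn]; ring)
  have hq := hE0 n q.arg (-q.arg - n) 0 (by ring)
  have hr := hE0 n r.arg (-r.arg - n + a.arg) (-a.arg) (by ring)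
  refine ⟨!![1, 0; 0, E (-r.arg - n + a.arg)], diagonal_mem_unitaryGroup (by simp) (hE1 _),
    !![E (-a.arg), 0; 0, E (-q.arg - n)], diagonal_mem_unitaryGroup (hE1 _) (hE1 _),
    E n, hE1 _, x, y, ?_, ?_⟩
  · rw [← hx1, ← hx2, Matrix.mul_fin_two, Matrix.mul_fin_two]
    simp only [hz, mul_one] at ha hb
    have e1 : a * E (-a.arg) = ‖a‖ := by
      linear_combination E (-a.arg) * hpolar a + ‖a‖ * ha
    have e2 : E (-r.arg - n + a.arg) * b * E (-q.arg - n) = ‖b‖ := by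
      linear_combination E (-r.arg - n + a.arg) * E (-q.arg - n) * hpolar b + ‖b‖ * hb
    simp only [mul_zero, zero_mul, add_zero, zero_add, one_mul, e1, e2]
  · rw [← hy1, ← hy2]
    simp only [hz, mul_one] at hq
    have e1 : E n * q * E (-q.arg - n) = ‖q‖ := by
      linear_combination E n * E (-q.arg - n) * hpolar q + ‖q‖ * hq
    have e2 : E (-r.arg - n + a.arg) * (E n * r) * E (-a.arg) = ‖r‖ := by
      linear_combination E (-r.arg - n + a.arg) * E n * E (-a.arg) * hpolar r + ‖r‖ * hr
    simp only [Matrix.smul_of, Matrix.smul_cons, Matrix.smul_empty, smul_eq_mul,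
      Matrix.mul_fin_two, mul_zero, zero_mul, add_zero, zero_add, one_mul, e1, e2]

theorem exists_normal_pair {M N : Matrix (Fin 2) (Fin 2) ℂ}
    (hM : (Mᴴ * M).trace = 1) (hN : (Nᴴ * N).trace = 1) (hMN : (Mᴴ * N).trace = 0) :
    ∃ U ∈ Matrix.unitaryGroup (Fin 2) ℂ, ∃ Z ∈ Matrix.unitaryGroup (Fin 2) ℂ,
    ∃ V ∈ Matrix.unitaryGroup (Fin 2) ℂ, ∃ x y : ℝ,
      U * (V 0 0 • M + V 1 0 • N) * Z
        = !![((Real.cos x : ℝ) : ℂ), 0; 0, ((Real.sin x : ℝ) : ℂ)] ∧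
      U * (V 0 1 • M + V 1 1 • N) * Z
        = !![0, ((Real.sin y : ℝ) : ℂ); ((Real.cos y : ℝ) : ℂ), 0] := by
  -- This is the condition tr(adj(M') N') = 0 for the rotated pair M', N' below, expanded by
  -- bilinearity.
  obtain ⟨x₀, x₁, hx, h0⟩ := exists_unit_isotropic (M.adjugate * N).trace
    (N.adjugate * N).trace (-(M.adjugate * M).trace)
  have hNM : (Nᴴ * M).trace = 0 := by
    rw [← Matrix.conjTranspose_conjTranspose M, ← Matrix.conjTranspose_mul,
      Matrix.trace_conjTranspose, hMN, star_zero]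
  set M' := x₀ • M + x₁ • N with hM'
  set N' := -star x₁ • M + star x₀ • N with hN'
  have hMM : (M'ᴴ * M').trace = 1 := by
    simp only [hM', Matrix.conjTranspose_add, Matrix.conjTranspose_smul, Matrix.add_mul,
      Matrix.mul_add, Matrix.smul_mul, Matrix.mul_smul, Matrix.trace_add, Matrix.trace_smul,
      hM, hN, hMN, hNM, smul_eq_mul]
    linear_combination hx
  have hNN : (N'ᴴ * N').trace = 1 := by
    simp only [hN', Matrix.conjTranspose_add, Matrix.conjTranspose_smul, Matrix.add_mul,
      Matrix.mul_add, Matrix.smul_mul, Matrix.mul_smul, Matrix.trace_add, Matrix.trace_smul,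
      hM, hN, hMN, hNM, smul_eq_mul, star_neg, star_star]
    linear_combination hx
  have hMN' : (M'ᴴ * N').trace = 0 := by
    simp only [hM', hN', Matrix.conjTranspose_add, Matrix.conjTranspose_smul, Matrix.add_mul,
      Matrix.mul_add, Matrix.smul_mul, Matrix.mul_smul, Matrix.trace_add, Matrix.trace_smul,
      hM, hN, hMN, hNM, smul_eq_mul]
    ring
  have hadj : (M'.adjugate * N').trace = 0 := by
    simp only [trace_adjugate_mul_fin_two] at h0 ⊢
    simp only [hM', hN', Matrix.add_apply, Matrix.smul_apply, smul_eq_mul]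
    linear_combination h0
  obtain ⟨U, hU, Z, hZ, a, b, q, r, h1, h2⟩ := exists_diagonal_offDiagonal hMM hMN' hadj
  rw [← trace_conjTranspose_mul_unitary hU hZ, h1, trace_conjTranspose_mul_fin_two] at hMM
  rw [← trace_conjTranspose_mul_unitary hU hZ, h2, trace_conjTranspose_mul_fin_two] at hNN
  obtain ⟨U', hU', Z', hZ', e, he, x, y, h3, h4⟩ := exists_real_diagonal_offDiagonal
    (a := a) (b := b) (q := q) (r := r) (by simpa using hMM) (by simpa using hNN)
  refine ⟨U' * U, mul_mem hU' hU, Z * Z', mul_mem hZ hZ',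
    columnUnitary x₀ x₁ * !![1, 0; 0, e],
    mul_mem (columnUnitary_mem hx) (diagonal_mem_unitaryGroup (by simp) he), x, y, ?_, ?_⟩
  · rw [← h3, ← h1, columnUnitary, Matrix.mul_fin_two, hM']
    simp [Matrix.mul_assoc]
  · rw [← h4, ← h2, columnUnitary, Matrix.mul_fin_two, hN']
    have e1 : (-star x₁ * e) • M + (star x₀ * e) • N = e • (-star x₁ • M + star x₀ • N) := by
      module
    simp only [Matrix.of_apply, Matrix.cons_val', Matrix.cons_val_zero, Matrix.cons_val_one,
      Matrix.cons_val_fin_one, mul_zero, zero_add, e1, Matrix.mul_assoc, Matrix.mul_smul,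
      Matrix.smul_mul]

theorem exists_krausIsometry_normal_form {W : Matrix (Fin 2 × Fin 2) (Fin 2) ℂ}
    (hW : Wᴴ * W = 1) :
    ∃ U ∈ Matrix.unitaryGroup (Fin 2) ℂ, ∃ Z ∈ Matrix.unitaryGroup (Fin 2) ℂ,
    ∃ V ∈ Matrix.unitaryGroup (Fin 2) ℂ, ∃ u v : ℝ,
      W = (U ⊗ₖ Z) * krausIsometry u v * V := by
  have hW' : ∀ i j, ((Matrix.of fun b e => W (b, e) i : Matrix (Fin 2) (Fin 2) ℂ)ᴴ *
      (Matrix.of fun b e => W (b, e) j : Matrix (Fin 2) (Fin 2) ℂ)).trace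
      = (1 : Matrix (Fin 2) (Fin 2) ℂ) i j := by
    intro i j
    rw [← hW, trace_conjTranspose_mul_fin_two, Matrix.mul_apply]
    simp [Fintype.sum_prod_type, Fin.sum_univ_two]
    ring
  obtain ⟨U, hU, Z, hZ, V, hV, x, y, h0, h1⟩ := exists_normal_pair (hW' 0 0) (hW' 1 1) (hW' 0 1)
  -- Reshaping a column of (U ⊗ Zᵀ) W into a matrix gives U M Z, hence the transpose.
  have key : (U ⊗ₖ Zᵀ) * W * V = krausIsometry (y - x) (y + x) := by
    ext ⟨b, e⟩ i
    have h0' := congrFun (congrFun h0 b) e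
    have h1' := congrFun (congrFun h1 b) e
    simp only [Matrix.mul_apply, Fin.sum_univ_two, Matrix.add_apply, Matrix.smul_apply,
      smul_eq_mul] at h0' h1'
    rw [Matrix.of_apply] at h0' h1'
    simp only [Matrix.mul_apply, Fintype.sum_prod_type, Fin.sum_univ_two, krausIsometry,
      krausPlus_half, krausMinus_half, Matrix.of_apply, Matrix.kroneckerMap_apply,
      Matrix.transpose_apply] at h0' h1' ⊢
    fin_cases i
    · trans
      · refine Eq.trans ?_ h0'
        simp only [Fin.zero_eta]
        ring
      · fin_cases b <;> fin_cases e <;> simp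
    · trans
      · refine Eq.trans ?_ h1'
        simp only [Fin.mk_one]
        ring
      · fin_cases b <;> fin_cases e <;> simp
  have hZT : Zᵀ ∈ Matrix.unitaryGroup (Fin 2) ℂ := Matrix.transpose_mem_unitaryGroup_iff.2 hZ
  refine ⟨star U, Unitary.star_mem hU, star Zᵀ, Unitary.star_mem hZT, star V,
    Unitary.star_mem hV, y - x, y + x, ?_⟩
  rw [← key]
  calc W = ((star U * U) ⊗ₖ (star Zᵀ * Zᵀ)) * W * (V * star V) := by
        rw [Matrix.mem_unitaryGroup_iff'.1 hU, Matrix.mem_unitaryGroup_iff'.1 hZT,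
          Matrix.mem_unitaryGroup_iff.1 hV, Matrix.one_kronecker_one, Matrix.one_mul,
          Matrix.mul_one]
    _ = _ := by
        rw [Matrix.mul_kronecker_mul]
        simp only [Matrix.mul_assoc]

/-! ### Reduction of the environment -/

theorem star_star_dotProduct {ι : Type} [Fintype ι] (x y : ι → ℂ) :
    star (star x ⬝ᵥ y) = star y ⬝ᵥ x := by
  rw [← Matrix.star_dotProduct_star, star_star, dotProduct_comm]

/-- The multiple c • y is a unit vector, or zero when y = 0. Both identities hold in either case, so
Gram–Schmidt needs no case split. -/
theorem exists_normalization {ι : Type} [Fintype ι] (y : ι → ℂ) : ∃ c : ℂ,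
    (star (c • y) ⬝ᵥ (c • y)) • (c • y) = c • y ∧ (star (c • y) ⬝ᵥ y) • (c • y) = y := by
  by_cases hy : y = 0
  · exact ⟨0, by simp, by simp [hy]⟩
  have h0 : 0 < star y ⬝ᵥ y := Matrix.dotProduct_star_self_pos_iff.2 hy
  obtain ⟨n, hn, hny⟩ : ∃ n : ℝ, 0 < n ∧ star y ⬝ᵥ y = n := by
    rw [Complex.pos_iff] at h0
    exact ⟨_, h0.1, Complex.ext rfl h0.2.symm⟩
  have hs := Real.sqrt_pos.2 hn
  have hss : ((√n : ℝ) : ℂ) * (√n : ℝ) = n := by exact_mod_cast Real.mul_self_sqrt hn.le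
  have hs0 : ((√n : ℝ) : ℂ) ≠ 0 := by exact_mod_cast hs.ne'
  have hn0 : (n : ℂ) ≠ 0 := by exact_mod_cast hn.ne'
  refine ⟨((√n : ℝ) : ℂ)⁻¹, ?_, ?_⟩ <;>
  · simp only [star_smul, smul_dotProduct, dotProduct_smul, hny, smul_smul, smul_eq_mul, star_inv₀,
      Complex.star_def, Complex.conj_ofReal, ← hss]
    field_simp
    try simp

/-- The rows of Y are the adjoints of the Gram–Schmidt vectors of y₀, y₁. These may vanish, so Y is
only a partial isometry. -/
theorem exists_projection_fixing_pair {ι : Type} [Fintype ι] (y₀ y₁ : ι → ℂ) :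
    ∃ Y : Matrix (Fin 2) ι ℂ, (Yᴴ * Y) * (Yᴴ * Y) = Yᴴ * Y ∧
      (Yᴴ * Y) *ᵥ y₀ = y₀ ∧ (Yᴴ * Y) *ᵥ y₁ = y₁ := by
  obtain ⟨c₀, h1, h2⟩ := exists_normalization y₀
  set f₀ := c₀ • y₀
  have hz : star f₀ ⬝ᵥ (y₁ - (star f₀ ⬝ᵥ y₁) • f₀) = 0 := by
    have h := congrArg (fun f => star f ⬝ᵥ y₁) h1
    have hr : star (star f₀ ⬝ᵥ f₀) = star f₀ ⬝ᵥ f₀ := star_star_dotProduct _ _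
    simp only [star_smul, smul_dotProduct, smul_eq_mul, hr] at h
    rw [dotProduct_sub, dotProduct_smul, smul_eq_mul]
    linear_combination -h
  obtain ⟨c₁, h3, h4⟩ := exists_normalization (y₁ - (star f₀ ⬝ᵥ y₁) • f₀)
  set f₁ := c₁ • (y₁ - (star f₀ ⬝ᵥ y₁) • f₀) with hf₁
  have h01 : star f₀ ⬝ᵥ f₁ = 0 := by rw [hf₁, dotProduct_smul, hz, smul_zero]
  have h10 : star f₁ ⬝ᵥ f₀ = 0 := by
    rw [← star_star_dotProduct, h01, star_zero]
  have hP : ∀ y, ((Matrix.of ![star f₀, star f₁])ᴴ * Matrix.of ![star f₀, star f₁]) *ᵥ y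
      = (star f₀ ⬝ᵥ y) • f₀ + (star f₁ ⬝ᵥ y) • f₁ := by
    intro y
    rw [← Matrix.mulVec_mulVec]
    ext k
    simp [Matrix.mulVec, dotProduct, Fin.sum_univ_two]
    ring
  have hP0 := (hP f₀).trans (by rw [h10, h1, zero_smul, add_zero] : _ = f₀)
  have hP1 := (hP f₁).trans (by rw [h01, h3, zero_smul, zero_add] : _ = f₁)
  refine ⟨Matrix.of ![star f₀, star f₁], ?_, ?_, ?_⟩
  · rw [← Matrix.mul_assoc]
    congr 1
    ext k i
    fin_cases i
    · have := congrFun hP0 k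
      simpa [Matrix.mul_apply, Matrix.mulVec, dotProduct] using this
    · have := congrFun hP1 k
      simpa [Matrix.mul_apply, Matrix.mulVec, dotProduct] using this
  · rw [hP]
    have : star f₁ ⬝ᵥ y₀ = 0 := by
      rw [← h2, dotProduct_smul, h10, smul_zero]
    rw [this, h2, zero_smul, add_zero]
  · rw [hP]
    have : star f₁ ⬝ᵥ y₁ = star f₁ ⬝ᵥ (y₁ - (star f₀ ⬝ᵥ y₁) • f₀) := by
      rw [dotProduct_sub, dotProduct_smul, h10, smul_zero, sub_zero]
    rw [this, h4]
    abel

/-- Equality in Cauchy–Schwarz. -/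
theorem exists_common_multiple {ι : Type} [Fintype ι] {x y : ι → ℂ}
    (h : (star x ⬝ᵥ x) * (star y ⬝ᵥ y) = (star x ⬝ᵥ y) * (star y ⬝ᵥ x)) :
    ∃ (z : ι → ℂ) (c c' : ℂ), x = c • z ∧ y = c' • z := by
  by_cases hx : x = 0
  · exact ⟨y, 0, 1, by simp [hx], by simp⟩
  have hxx : star x ⬝ᵥ x ≠ 0 := fun h => hx (dotProduct_star_self_eq_zero.1 h)
  refine ⟨x, 1, (star x ⬝ᵥ y) / (star x ⬝ᵥ x), by simp, ?_⟩
  rw [← sub_eq_zero, ← dotProduct_star_self_eq_zero]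
  have hr : star (star x ⬝ᵥ x) = star x ⬝ᵥ x := star_star_dotProduct _ _
  have hxy : star (star x ⬝ᵥ y) = star y ⬝ᵥ x := star_star_dotProduct _ _
  simp only [star_sub, star_smul, sub_dotProduct, dotProduct_sub, smul_dotProduct,
    dotProduct_smul, smul_eq_mul, star_div₀, hr, hxy]
  field_simp
  linear_combination h

theorem Matrix.PosSemidef.adjugate_fin_two {τ : Matrix (Fin 2) (Fin 2) ℂ} (hτ : τ.PosSemidef) :
    τ.adjugate.PosSemidef := by
  have h := hτ.transpose.mul_mul_conjTranspose_same (!![0, 1; -1, 0] : Matrix (Fin 2) (Fin 2) ℂ)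
  suffices e : τ.adjugate = !![0, 1; -1, 0] * τᵀ * (!![0, 1; -1, 0] : Matrix _ _ ℂ)ᴴ from e ▸ h
  rw [Matrix.adjugate_fin_two, Matrix.eta_fin_two τᵀ, Matrix.conjTranspose_fin_two_of,
    Matrix.mul_fin_two, Matrix.mul_fin_two]
  simp

/-- A positive functional that vanishes on an invertible positive matrix vanishes. -/
theorem positive_functional_eq_zero (f : Matrix (Fin 2) (Fin 2) ℂ →ₗ[ℂ] ℂ)
    (hf : ∀ X : Matrix (Fin 2) (Fin 2) ℂ, X.PosSemidef → 0 ≤ f X)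
    {σ : Matrix (Fin 2) (Fin 2) ℂ} (hσ : σ.PosSemidef) (hdet : σ.det ≠ 0) (h0 : f σ = 0)
    {τ : Matrix (Fin 2) (Fin 2) ℂ} (hτ : τ.PosSemidef) : f τ = 0 := by
  have h1 : f 1 = 0 := by
    -- By Cayley–Hamilton f(σ²) = -det σ · f(1), where f(σ²), det σ and f(1) are all nonnegative.
    have hsq : σ * σ = σ.trace • σ - σ.det • 1 := by
      rw [Matrix.eta_fin_two σ, Matrix.trace_fin_two_of, Matrix.det_fin_two_of, Matrix.mul_fin_two,
        Matrix.one_fin_two]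
      ext i j
      fin_cases i <;> fin_cases j <;> simp <;> ring
    have h2 := hf (σ * σ) (by
      nth_rewrite 1 [← hσ.isHermitian]
      exact Matrix.posSemidef_conjTranspose_mul_self σ)
    rw [hsq, map_sub, map_smul, map_smul, h0, smul_zero, zero_sub, smul_eq_mul] at h2
    have h3 : σ.det * f 1 = 0 :=
      le_antisymm (neg_nonneg.1 h2) (mul_nonneg hσ.det_nonneg (hf _ Matrix.PosSemidef.one))
    exact (mul_eq_zero.1 h3).resolve_left hdet
  -- τ and its adjugate are both positive and add up to a multiple of 1.
  have h4 : f τ + f τ.adjugate = 0 := by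
    have : τ + τ.adjugate = τ.trace • 1 := by
      rw [Matrix.adjugate_fin_two, Matrix.eta_fin_two τ, Matrix.trace_fin_two_of,
        Matrix.one_fin_two]
      ext i j
      fin_cases i <;> fin_cases j <;> simp
      ring
    rw [← map_add, this, map_smul, h1, smul_zero]
  have h5 := hf _ hτ
  have h6 := hf _ hτ.adjugate_fin_two
  exact le_antisymm (by rw [← h4]; exact le_add_of_nonneg_right h6) h5

theorem single_posSemidef {n : Type} [Fintype n] [DecidableEq n] (a : n) :
    (Matrix.single a a (1 : ℂ)).PosSemidef := by
  have h := Matrix.posSemidef_conjTranspose_mul_self (Matrix.single a a (1 : ℂ))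
  simpa using h

theorem mul_single_mul_conjTranspose {m : Type} (W : Matrix m (Fin 2) ℂ) (a : Fin 2) (p q : m) :
    (W * Matrix.single a a (1 : ℂ) * Wᴴ) p q = W p a * star (W q a) := by
  rw [Matrix.mul_apply, Fin.sum_univ_two]
  fin_cases a <;> simp [Matrix.mul_apply, Matrix.single_apply]

theorem exists_environment_projection {d : ℕ} {Φ : QubitMap}
    {Φc Ψ : Matrix (Fin 2) (Fin 2) ℂ →ₗ[ℂ] Matrix (Fin d) (Fin d) ℂ}
    {W : Matrix (Fin 2 × Fin d) (Fin 2) ℂ}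
    (hΦ : ∀ ρ, Φ ρ = partialTraceRight (W * ρ * Wᴴ))
    (hΦc : ∀ ρ, Φc ρ = partialTraceLeft (W * ρ * Wᴴ))
    (hΨ : IsCompletelyPositive Ψ) (hΦpos : ∀ ρ : Matrix (Fin 2) (Fin 2) ℂ,
      ρ.PosSemidef → (Φ ρ).PosSemidef) (hcomp : Ψ ∘ₗ Φ = Φc) :
    ∃ Y : Matrix (Fin 2) (Fin d) ℂ, (Yᴴ * Y) * (Yᴴ * Y) = Yᴴ * Y ∧
      ∀ a b, (Yᴴ * Y) *ᵥ (fun k => W (b, k) a) = fun k => W (b, k) a := by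
  have hΦs : ∀ a b b', Φ (Matrix.single a a 1) b b'
      = star (fun k => W (b', k) a) ⬝ᵥ fun k => W (b, k) a := by
    intro a b b'
    rw [hΦ]
    simp only [partialTraceRight, Matrix.of_apply, mul_single_mul_conjTranspose, dotProduct,
      Pi.star_apply]
    exact Finset.sum_congr rfl fun _ _ => mul_comm _ _
  by_cases hdet : ∃ a, (Φ (Matrix.single a a 1)).det ≠ 0
  · obtain ⟨a, ha⟩ := hdet
    obtain ⟨Y, hY, h0, h1⟩ := exists_projection_fixing_pair (fun k => W (0, k) a)
      (fun k => W (1, k) a)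
    have hH : (Yᴴ * Y)ᴴ = Yᴴ * Y := by simp
    generalize hP : Yᴴ * Y = P at *
    refine ⟨Y, by rw [hP, hY], fun a' b' => ?_⟩
    rw [hP]
    set w : Fin d → ℂ := fun k => W (b', k) a' with hw
    -- z is the part of w outside the range of P; testing Φᶜ = Ψ ∘ Φ against z will show that w is
    -- orthogonal to z, so z = 0.
    set z := w - P *ᵥ w with hz
    have hzy : ∀ y, P *ᵥ y = y → star z ⬝ᵥ y = 0 := by
      intro y hy
      rw [hz, star_sub, sub_dotProduct, Matrix.star_mulVec, hH, ← Matrix.dotProduct_mulVec, hy,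
        sub_self]
    let f : Matrix (Fin 2) (Fin 2) ℂ →ₗ[ℂ] ℂ :=
      { toFun := fun X => star z ⬝ᵥ (Ψ X *ᵥ z)
        map_add' := fun X X' => by rw [map_add, Matrix.add_mulVec, dotProduct_add]
        map_smul' := fun c X => by
          rw [map_smul, Matrix.smul_mulVec, dotProduct_smul, RingHom.id_apply] }
    have hf : ∀ a, f (Φ (Matrix.single a a 1))
        = ∑ b, (star z ⬝ᵥ fun k => W (b, k) a) * star (star z ⬝ᵥ fun k => W (b, k) a) := by
      intro a
      change star z ⬝ᵥ ((Ψ ∘ₗ Φ) (Matrix.single a a 1) *ᵥ z) = _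
      rw [hcomp, hΦc]
      have e : partialTraceLeft (W * Matrix.single a a (1 : ℂ) * Wᴴ)
          = ∑ b, Matrix.vecMulVec (fun k => W (b, k) a) (star fun k => W (b, k) a) := by
        ext k l
        simp only [partialTraceLeft, Matrix.of_apply, mul_single_mul_conjTranspose,
          Matrix.sum_apply, Matrix.vecMulVec_apply, Pi.star_apply]
      rw [e, Matrix.sum_mulVec, dotProduct_sum]
      refine Finset.sum_congr rfl fun b _ => ?_
      rw [Matrix.vecMulVec_mulVec, ← Matrix.star_dotProduct_star, star_star]
      simp [dotProduct_comm]
      exact mul_comm _ _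
    have hfa : f (Φ (Matrix.single a a 1)) = 0 := by
      rw [hf, Fin.sum_univ_two, hzy _ h0, hzy _ h1]
      simp
    have hfa' := positive_functional_eq_zero f
      (fun X hX => (hΨ.posSemidef hX).dotProduct_mulVec_nonneg z) (hΦpos _ (single_posSemidef a))
      ha hfa (hΦpos _ (single_posSemidef a'))
    rw [hf, Finset.sum_eq_zero_iff_of_nonneg fun b _ => mul_star_self_nonneg _] at hfa'
    have hzw : star z ⬝ᵥ w = 0 := by simpa using hfa' b' (Finset.mem_univ _)
    have hzz : star z ⬝ᵥ z = 0 := by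
      nth_rewrite 2 [hz]
      rw [dotProduct_sub, hzw, hzy (P *ᵥ w) (by rw [Matrix.mulVec_mulVec, hY]), sub_zero]
    exact (sub_eq_zero.1 (dotProduct_star_self_eq_zero.1 hzz)).symm
  -- Φ(|a⟩⟨a|) is a Gram matrix of the vectors W(0,·)a and W(1,·)a; being singular, it makes them
  -- parallel.
  · push Not at hdet
    have hz : ∀ a, ∃ (z : Fin d → ℂ) (c c' : ℂ),
        (fun k => W (0, k) a) = c • z ∧ (fun k => W (1, k) a) = c' • z := by
      intro a
      apply exists_common_multiple
      have h := hdet a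
      rw [Matrix.det_fin_two, hΦs, hΦs, hΦs, hΦs] at h
      linear_combination h
    choose z c c' hc hc' using hz
    obtain ⟨Y, hY, h0, h1⟩ := exists_projection_fixing_pair (z 0) (z 1)
    have hz' : ∀ a, (Yᴴ * Y) *ᵥ z a = z a := fun a => by fin_cases a <;> assumption
    refine ⟨Y, hY, fun a b => ?_⟩
    fin_cases b
    · exact (congrArg _ (hc a)).trans <| by rw [Matrix.mulVec_smul, hz', ← hc]; rfl
    · exact (congrArg _ (hc' a)).trans <| by rw [Matrix.mulVec_smul, hz', ← hc']; rfl

/-! ### Necessity of the normal form -/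

/-- Cyclicity of the trace on the environment alone. -/
theorem partialTraceRight_one_kronecker_conj {b e e' : Type} [Fintype b] [DecidableEq b]
    [Fintype e] [Fintype e'] (Y : Matrix e' e ℂ) (X : Matrix (b × e) (b × e) ℂ) :
    partialTraceRight (((1 : Matrix b b ℂ) ⊗ₖ Y) * X * ((1 : Matrix b b ℂ) ⊗ₖ Y)ᴴ)
      = partialTraceRight (((1 : Matrix b b ℂ) ⊗ₖ (Yᴴ * Y)) * X) := by
  ext i j
  simp only [partialTraceRight, Matrix.mul_apply, Matrix.of_apply, Matrix.conjTranspose_apply,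
    Matrix.kroneckerMap_apply, Fintype.sum_prod_type, Matrix.one_apply, ite_mul, one_mul, zero_mul,
    apply_ite star, star_zero, mul_ite, mul_zero, Finset.sum_ite_irrel, Finset.sum_const_zero,
    Finset.sum_ite_eq, Finset.mem_univ, if_true, Finset.sum_mul]
  rw [Finset.sum_comm]
  refine Finset.sum_congr rfl fun l _ => ?_
  rw [Finset.sum_comm]
  refine Finset.sum_congr rfl fun l' _ => Finset.sum_congr rfl fun k _ => ?_
  ring

theorem krausChannel_pauliX (u v : ℝ) :
    krausChannel u v pauliX = ((Real.cos u : ℝ) : ℂ) • pauliX := by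
  rw [krausChannel_eq_blochChannel, pauliX, blochChannel_fin_two]
  ext i j
  fin_cases i <;> fin_cases j <;> simp [-Complex.ofReal_cos] <;> ring

/-- The projections `(1 ± σ_x)/2` for `s = ±1`. -/
theorem one_add_pauliX_posSemidef {s : ℂ} (hs : s * s = 1) (hs' : star s = s) :
    ((1 / 2 : ℂ) • (1 + s • pauliX)).PosSemidef := by
  have h := Matrix.posSemidef_conjTranspose_mul_self (!![1 / 2, s / 2; s / 2, 1 / 2])
  rw [Matrix.conjTranspose_fin_two_of, Matrix.mul_fin_two] at h
  convert h using 1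
  rw [Matrix.one_fin_two, pauliX]
  ext i j
  fin_cases i <;> fin_cases j <;> simp at hs' ⊢
  · rw [hs']; linear_combination -(1 / 4) * hs
  · rw [hs']; ring
  · rw [hs']; ring
  · rw [hs']; linear_combination -(1 / 4) * hs

/-- Test positivity on (1, ±1): tr(T σ_x) is at most tr T in absolute value. -/
theorem abs_offDiagonal_le_of_trace_le_one {T : Matrix (Fin 2) (Fin 2) ℂ} (hT : T.PosSemidef)
    (htr : T.trace ≤ 1) : |(T 0 1 + T 1 0).re| ≤ 1 := by
  have h1 := (Complex.le_def.1 (hT.dotProduct_mulVec_nonneg ![1, 1])).1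
  have h2 := (Complex.le_def.1 (hT.dotProduct_mulVec_nonneg ![1, -1])).1
  have h3 := (Complex.le_def.1 htr).1
  rw [Matrix.trace_fin_two] at h3
  simp [Matrix.mulVec, dotProduct, Fin.sum_univ_two] at h1 h2 h3
  rw [Complex.add_re, abs_le]
  constructor <;> linarith

/-- Contractivity on `σ_x` of positive maps that do not increase the trace. -/
theorem abs_le_of_contraction {Θ : QubitMap}
    (hpos : ∀ ρ : Matrix (Fin 2) (Fin 2) ℂ, ρ.PosSemidef → (Θ ρ).PosSemidef)
    (htr : ∀ ρ : Matrix (Fin 2) (Fin 2) ℂ, ρ.PosSemidef → (Θ ρ).trace ≤ ρ.trace) {c s : ℝ}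
    (h : (c : ℂ) • Θ pauliX = (s : ℂ) • pauliX) : |s| ≤ |c| := by
  have hb : ∀ t : ℂ, t * t = 1 → star t = t →
      |(Θ ((1 / 2 : ℂ) • (1 + t • pauliX)) 0 1 + Θ ((1 / 2 : ℂ) • (1 + t • pauliX)) 1 0).re|
        ≤ 1 := by
    intro t ht ht'
    have hP := one_add_pauliX_posSemidef ht ht'
    refine abs_offDiagonal_le_of_trace_le_one (hpos _ hP) ((htr _ hP).trans_eq ?_)
    simp [Matrix.trace_fin_two, pauliX]
  have h1 := hb 1 (by simp) (by simp)
  have h2 := hb (-1) (by simp) (by simp)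
  set A := Θ ((1 / 2 : ℂ) • (1 + (1 : ℂ) • pauliX)) with hA
  set B := Θ ((1 / 2 : ℂ) • (1 + (-1 : ℂ) • pauliX)) with hB
  -- σ_x is the difference of its two spectral projections, whose images each pair with σ_x to at
  -- most 1 in absolute value.
  have hX : Θ pauliX = A - B := by
    rw [hA, hB, ← map_sub]
    congr 1
    module
  rw [hX] at h
  have e1 := congrArg Complex.re (congrFun (congrFun h 0) 1)
  have e2 := congrArg Complex.re (congrFun (congrFun h 1) 0)
  simp [pauliX] at e1 e2
  have e3 : c * ((A 0 1 + A 1 0).re - (B 0 1 + B 1 0).re) = 2 * s := by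
    rw [Complex.add_re, Complex.add_re]
    linarith
  have h3 : |(A 0 1 + A 1 0).re - (B 0 1 + B 1 0).re| ≤ 2 := (abs_sub _ _).trans (by linarith)
  have h4 := congrArg abs e3
  rw [abs_mul, abs_mul, abs_two] at h4
  nlinarith [abs_nonneg c]

/-- The loss of trace is tr((1 - P) X (1 - P)) ≥ 0 for the projection P = Yᴴ Y. -/
theorem trace_conj_le {n m : Type} [Fintype n] [DecidableEq n] [Fintype m] {Y : Matrix m n ℂ}
    (hY : (Yᴴ * Y) * (Yᴴ * Y) = Yᴴ * Y) {X : Matrix n n ℂ} (hX : X.PosSemidef) :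
    (Y * X * Yᴴ).trace ≤ X.trace := by
  have h := (hX.mul_mul_conjTranspose_same (1 - Yᴴ * Y)).trace_nonneg
  have hH : (1 - Yᴴ * Y)ᴴ = 1 - Yᴴ * Y := by simp
  have hsq : (1 - Yᴴ * Y) * (1 - Yᴴ * Y) = 1 - Yᴴ * Y := by
    simp [Matrix.sub_mul, Matrix.mul_sub, hY]
  rw [hH, Matrix.trace_mul_comm, ← Matrix.mul_assoc, hsq, Matrix.sub_mul, Matrix.one_mul,
    Matrix.trace_sub, sub_nonneg] at h
  rwa [Matrix.mul_assoc, Matrix.trace_mul_comm, Matrix.mul_assoc, Matrix.trace_mul_comm]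

theorem IsDegradable.exists_unitarilyEquivalent {Φ : QubitMap} (hch : IsChannel Φ)
    (hΦ : IsDegradable Φ) :
    ∃ u v : ℝ, |Real.sin v| ≤ |Real.cos u| ∧ UnitarilyEquivalent Φ (krausChannel u v) := by
  obtain ⟨d, Φc, Ψ, ⟨W, hW, hR, hL⟩, hΨ, hcomp⟩ := hΦ
  obtain ⟨Y, hY, hYW⟩ := exists_environment_projection hR hL hΨ.completelyPositive
    (fun ρ hρ => hch.completelyPositive.posSemidef hρ) hcomp
  have hPW : ((1 : Matrix (Fin 2) (Fin 2) ℂ) ⊗ₖ (Yᴴ * Y)) * W = W := by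
    ext ⟨b, k⟩ a
    have h := congrFun (hYW a b) k
    rw [← h, Matrix.mul_apply, Fintype.sum_prod_type, Finset.sum_eq_single b]
    · simp [Matrix.mulVec, dotProduct, Matrix.kroneckerMap_apply]
    · intro b' _ hb'
      simp [Matrix.kroneckerMap_apply, Matrix.one_apply_ne hb'.symm]
    · simp
  have hW2 : (((1 : Matrix (Fin 2) (Fin 2) ℂ) ⊗ₖ Y) * W)ᴴ *
      (((1 : Matrix (Fin 2) (Fin 2) ℂ) ⊗ₖ Y) * W) = 1 := by
    rw [Matrix.conjTranspose_mul, Matrix.mul_assoc, ← Matrix.mul_assoc _ _ W,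
      Matrix.conjTranspose_kronecker, ← Matrix.mul_kronecker_mul, Matrix.conjTranspose_one,
      Matrix.one_mul, hPW, hW]
  obtain ⟨U, hU, Z, hZ, V, hV, u, v, hnf⟩ := exists_krausIsometry_normal_form hW2
  have hU' : Uᴴ * U = 1 := Matrix.mem_unitaryGroup_iff'.1 hU
  have hZ' : Zᴴ * Z = 1 := Matrix.mem_unitaryGroup_iff'.1 hZ
  have hV' : V * Vᴴ = 1 := Matrix.mem_unitaryGroup_iff.1 hV
  have hconj : ∀ ρ, ((1 : Matrix (Fin 2) (Fin 2) ℂ) ⊗ₖ Y) * (W * ρ * Wᴴ) *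
      ((1 : Matrix (Fin 2) (Fin 2) ℂ) ⊗ₖ Y)ᴴ = (U ⊗ₖ Z) * (krausIsometry u v * (V * ρ * Vᴴ)
        * (krausIsometry u v)ᴴ) * (U ⊗ₖ Z)ᴴ := by
    intro ρ
    trans (((1 : Matrix (Fin 2) (Fin 2) ℂ) ⊗ₖ Y) * W) * ρ *
      (((1 : Matrix (Fin 2) (Fin 2) ℂ) ⊗ₖ Y) * W)ᴴ
    · rw [Matrix.conjTranspose_mul]
      simp only [Matrix.mul_assoc]
    · rw [hnf, Matrix.conjTranspose_mul, Matrix.conjTranspose_mul]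
      simp only [Matrix.mul_assoc]
  have hΦ' : ∀ ρ, Φ ρ = U * krausChannel u v (V * ρ * Vᴴ) * Uᴴ := by
    intro ρ
    rw [← partialTraceRight_krausIsometry, ← partialTraceRight_kronecker_conj U hZ', ← hconj,
      partialTraceRight_one_kronecker_conj, hR, ← Matrix.mul_assoc, ← Matrix.mul_assoc, hPW]
  have hΦc' : ∀ ρ, Y * Φc ρ * Yᴴ
      = Z * blochChannel (v - Real.pi / 2) (u - Real.pi / 2) (V * ρ * Vᴴ) * Zᴴ := by
    intro ρ
    rw [← partialTraceLeft_krausIsometry, ← partialTraceLeft_kronecker_conj hU' Z, ← hconj,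
      partialTraceLeft_kronecker_conj (by simp), hL]
  refine ⟨u, v, ?_, U, hU, V, hV, hΦ'⟩
  -- The degrading map is read in the normal-form frames: undo the output unitary, degrade, compress
  -- to the qubit environment, undo Z.
  refine abs_le_of_contraction (Θ := conjMap (Zᴴ * Y) ∘ₗ Ψ ∘ₗ conjMap U) ?_ ?_ ?_
  · exact fun ρ hρ => ((isCompletelyPositive_conjMap _).comp
      (hΨ.completelyPositive.comp (isCompletelyPositive_conjMap _))).posSemidef hρ
  · intro ρ hρ
    have hΨU := hΨ.comp (isChannel_conjMap hU')
    rw [← hΨU.tracePreserving ρ]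
    have hZY : (Zᴴ * Y)ᴴ * (Zᴴ * Y) = Yᴴ * Y := by
      rw [Matrix.conjTranspose_mul, Matrix.conjTranspose_conjTranspose, Matrix.mul_assoc,
        ← Matrix.mul_assoc Z, (show Z * Zᴴ = 1 from Matrix.mem_unitaryGroup_iff.1 hZ), Matrix.one_mul]
    exact trace_conj_le (by rw [hZY, hY]) (hΨU.completelyPositive.posSemidef hρ)
  · have hρ : V * (Vᴴ * pauliX * V) * Vᴴ = pauliX := by
      calc _ = (V * Vᴴ) * pauliX * (V * Vᴴ) := by simp only [Matrix.mul_assoc]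
        _ = _ := by rw [hV', Matrix.one_mul, Matrix.mul_one]
    have h1 := hΦ' (Vᴴ * pauliX * V)
    have h2 := hΦc' (Vᴴ * pauliX * V)
    rw [hρ, krausChannel_pauliX] at h1
    rw [hρ, ← krausChannel_eq_blochChannel, krausChannel_pauliX, Real.cos_sub_pi_div_two, ← hcomp,
      LinearMap.comp_apply, h1] at h2
    calc ((Real.cos u : ℝ) : ℂ) • (conjMap (Zᴴ * Y) ∘ₗ Ψ ∘ₗ conjMap U) pauliX
        = Zᴴ * (Y * Ψ (U * (((Real.cos u : ℝ) : ℂ) • pauliX) * Uᴴ) * Yᴴ) * Z := by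
          simp [conjMap_apply, Matrix.mul_assoc]
      _ = (Zᴴ * Z) * (((Real.sin v : ℝ) : ℂ) • pauliX) * (Zᴴ * Z) := by
          rw [h2]; simp only [Matrix.mul_assoc]
      _ = _ := by rw [hZ', Matrix.one_mul, Matrix.mul_one]

/-! ### Sufficiency, and anti-degradability -/

/-- The dilation is (U ⊗ 1) K V. The output unitary U disappears when the output is traced out, so
only V survives in the complement. -/
theorem UnitarilyEquivalent.exists_complementary {Φ : QubitMap} {u v : ℝ}
    (h : UnitarilyEquivalent Φ (krausChannel u v)) :
    ∃ U ∈ Matrix.unitaryGroup (Fin 2) ℂ, ∃ V ∈ Matrix.unitaryGroup (Fin 2) ℂ,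
      Φ = conjMap U ∘ₗ blochChannel u v ∘ₗ conjMap V ∧
      IsComplementary Φ (blochChannel (v - Real.pi / 2) (u - Real.pi / 2) ∘ₗ conjMap V) := by
  obtain ⟨U, hU, V, hV, h⟩ := h
  have hU' : Uᴴ * U = 1 := Matrix.mem_unitaryGroup_iff'.1 hU
  have hV' : Vᴴ * V = 1 := Matrix.mem_unitaryGroup_iff'.1 hV
  have hconj : ∀ ρ, ((U ⊗ₖ (1 : Matrix (Fin 2) (Fin 2) ℂ)) * krausIsometry u v * V) * ρ *
      ((U ⊗ₖ (1 : Matrix (Fin 2) (Fin 2) ℂ)) * krausIsometry u v * V)ᴴ =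
      (U ⊗ₖ (1 : Matrix (Fin 2) (Fin 2) ℂ)) * (krausIsometry u v * (V * ρ * Vᴴ)
        * (krausIsometry u v)ᴴ) * (U ⊗ₖ (1 : Matrix (Fin 2) (Fin 2) ℂ))ᴴ := fun ρ => by
    rw [Matrix.conjTranspose_mul, Matrix.conjTranspose_mul]
    simp only [Matrix.mul_assoc]
  refine ⟨U, hU, V, hV, LinearMap.ext fun ρ => ?_,
    (U ⊗ₖ (1 : Matrix (Fin 2) (Fin 2) ℂ)) * krausIsometry u v * V, ?_, fun ρ => ?_, fun ρ => ?_⟩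
  · rw [h, krausChannel_eq_blochChannel]
    rfl
  · have e : (U ⊗ₖ (1 : Matrix (Fin 2) (Fin 2) ℂ))ᴴ * (U ⊗ₖ (1 : Matrix (Fin 2) (Fin 2) ℂ)) = 1 := by
      rw [Matrix.conjTranspose_kronecker, ← Matrix.mul_kronecker_mul, hU', Matrix.conjTranspose_one,
        Matrix.one_mul, Matrix.one_kronecker_one]
    calc _ = Vᴴ * ((krausIsometry u v)ᴴ * ((U ⊗ₖ (1 : Matrix (Fin 2) (Fin 2) ℂ))ᴴ *
          (U ⊗ₖ (1 : Matrix (Fin 2) (Fin 2) ℂ))) * krausIsometry u v) * V := by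
          rw [Matrix.conjTranspose_mul, Matrix.conjTranspose_mul]
          simp only [Matrix.mul_assoc]
      _ = 1 := by rw [e, Matrix.mul_one, krausIsometry_isometry, Matrix.mul_one, hV']
  · rw [hconj, partialTraceRight_kronecker_conj U (by simp), partialTraceRight_krausIsometry, h]
  · rw [hconj, partialTraceLeft_kronecker_conj hU', partialTraceLeft_krausIsometry]
    simp [conjMap_apply]

theorem isChannel_blochChannel (u v : ℝ) : IsChannel (blochChannel u v) :=
  krausChannel_eq_blochChannel u v ▸ isChannel_krausChannel u v

theorem exists_blochChannel_degrading {u v : ℝ} (huv : |Real.sin v| ≤ |Real.cos u|) :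
    ∃ θ₁ θ₂ : ℝ, blochChannel θ₁ θ₂ ∘ₗ blochChannel u v =
      blochChannel (v - Real.pi / 2) (u - Real.pi / 2) :=
  ⟨_, _, blochChannel_arccos_degrading huv⟩

theorem conjMap_comp_cancel {n : Type} [Fintype n] [DecidableEq n] {U : Matrix n n ℂ}
    (hU : Uᴴ * U = 1) (ρ : Matrix n n ℂ) : conjMap Uᴴ (conjMap U ρ) = ρ := by
  calc Uᴴ * (U * ρ * Uᴴ) * Uᴴᴴ = (Uᴴ * U) * ρ * (Uᴴ * U) := by
        rw [Matrix.conjTranspose_conjTranspose]; simp only [Matrix.mul_assoc]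
    _ = ρ := by rw [hU, Matrix.one_mul, Matrix.mul_one]

theorem UnitarilyEquivalent.isDegradable {Φ : QubitMap} {u v : ℝ}
    (huv : |Real.sin v| ≤ |Real.cos u|) (h : UnitarilyEquivalent Φ (krausChannel u v)) :
    IsDegradable Φ := by
  obtain ⟨U, hU, V, -, rfl, hc⟩ := h.exists_complementary
  have hU' : Uᴴ * U = 1 := Matrix.mem_unitaryGroup_iff'.1 hU
  have hU'' : Uᴴᴴ * Uᴴ = 1 := by
    rw [Matrix.conjTranspose_conjTranspose]
    exact Matrix.mem_unitaryGroup_iff.1 hU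
  obtain ⟨θ₁, θ₂, hd⟩ := exists_blochChannel_degrading huv
  refine ⟨2, _, blochChannel θ₁ θ₂ ∘ₗ conjMap Uᴴ, hc, (isChannel_blochChannel _ _).comp
    (isChannel_conjMap hU''), ?_⟩
  rw [← hd]
  refine LinearMap.ext fun ρ => ?_
  simp only [LinearMap.comp_apply, conjMap_comp_cancel hU']

/-- Shifting both angles by π flips the signs on σ_x and σ_y only, which is conjugation by σ_z. -/
theorem blochChannel_sub_pi (u v : ℝ) :
    conjMap pauliZ ∘ₗ blochChannel (u - Real.pi) (v - Real.pi) = blochChannel u v := by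
  refine LinearMap.ext fun ρ => ?_
  rw [LinearMap.comp_apply, Matrix.eta_fin_two ρ, blochChannel_fin_two, blochChannel_fin_two,
    conjMap_apply, pauliZ, Matrix.conjTranspose_fin_two_of, Matrix.mul_fin_two, Matrix.mul_fin_two]
  ext i j
  fin_cases i <;> fin_cases j <;>
    simp [Real.sin_sub_pi, Real.cos_sub_pi, -Complex.ofReal_cos, -Complex.ofReal_sin] <;> ring

theorem UnitarilyEquivalent.isAntiDegradable {Φ : QubitMap} {u v : ℝ}
    (huv : |Real.cos u| ≤ |Real.sin v|) (h : UnitarilyEquivalent Φ (krausChannel u v)) :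
    IsAntiDegradable Φ := by
  obtain ⟨U, hU, V, -, rfl, hc⟩ := h.exists_complementary
  have hU' : Uᴴ * U = 1 := Matrix.mem_unitaryGroup_iff'.1 hU
  -- The complement is itself in the degradable range, and its own complement is Φ(u - π, v - π).
  obtain ⟨θ₁, θ₂, hd⟩ := exists_blochChannel_degrading (u := v - Real.pi / 2) (v := u - Real.pi / 2)
    (by rwa [Real.sin_sub_pi_div_two, Real.cos_sub_pi_div_two, abs_neg])
  rw [sub_sub, sub_sub, add_halves] at hd
  have hZ : pauliZᴴ * pauliZ = 1 := by
    rw [pauliZ, Matrix.conjTranspose_fin_two_of, Matrix.mul_fin_two, Matrix.one_fin_two]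
    simp
  refine ⟨2, _, conjMap U ∘ₗ conjMap pauliZ ∘ₗ blochChannel θ₁ θ₂, hc, (isChannel_conjMap hU').comp
    ((isChannel_conjMap hZ).comp (isChannel_blochChannel _ _)), ?_⟩
  refine LinearMap.ext fun ρ => ?_
  rw [← blochChannel_sub_pi u v, ← hd]
  simp only [LinearMap.comp_apply]

/-! ### Choi rank -/

theorem trace_krausPlus_krausPlus (u v : ℝ) : ((krausPlus u v)ᴴ * krausPlus u v).trace
    = 1 + ((Real.cos u * Real.cos v : ℝ) : ℂ) := by
  obtain ⟨x, y, rfl, rfl⟩ := exists_half_angles u v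
  have hx := ofReal_sin_sq_add_cos_sq x
  have hy := ofReal_sin_sq_add_cos_sq y
  rw [trace_conjTranspose_mul_fin_two, krausPlus_half]
  simp only [Real.cos_add, Real.cos_sub, Complex.ofReal_add, Complex.ofReal_sub, Complex.ofReal_mul]
  simp [-Complex.ofReal_cos, -Complex.ofReal_sin]
  generalize ((Real.sin x : ℝ) : ℂ) = sx, ((Real.cos x : ℝ) : ℂ) = cx,
    ((Real.sin y : ℝ) : ℂ) = sy, ((Real.cos y : ℝ) : ℂ) = cy at *
  grind

theorem trace_krausMinus_krausMinus (u v : ℝ) : ((krausMinus u v)ᴴ * krausMinus u v).trace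
    = 1 - ((Real.cos u * Real.cos v : ℝ) : ℂ) := by
  obtain ⟨x, y, rfl, rfl⟩ := exists_half_angles u v
  have hx := ofReal_sin_sq_add_cos_sq x
  have hy := ofReal_sin_sq_add_cos_sq y
  rw [trace_conjTranspose_mul_fin_two, krausMinus_half]
  simp only [Real.cos_add, Real.cos_sub, Complex.ofReal_add, Complex.ofReal_sub, Complex.ofReal_mul]
  simp [-Complex.ofReal_cos, -Complex.ofReal_sin]
  generalize ((Real.sin x : ℝ) : ℂ) = sx, ((Real.cos x : ℝ) : ℂ) = cx,
    ((Real.sin y : ℝ) : ℂ) = sy, ((Real.cos y : ℝ) : ℂ) = cy at *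
  grind

/-- The Choi matrix is N Nᴴ, where the columns of N are the vectorised Kraus operators. Its rank is
that of their Gram matrix Nᴴ N, which the unitaries do not change. -/
theorem choiRank_of_unitarilyEquivalent {Φ : QubitMap} {u v : ℝ}
    (h : UnitarilyEquivalent Φ (krausChannel u v)) :
    choiRank Φ = (Matrix.diagonal ![1 + ((Real.cos u * Real.cos v : ℝ) : ℂ),
      1 - ((Real.cos u * Real.cos v : ℝ) : ℂ)]).rank := by
  obtain ⟨U, hU, V, hV, h⟩ := h
  set K : Fin 2 → Matrix (Fin 2) (Fin 2) ℂ :=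
    fun k => U * ![krausPlus u v, krausMinus u v] k * V with hK
  have hΦ : ∀ ρ, Φ ρ = ∑ k, K k * ρ * (K k)ᴴ := by
    intro ρ
    rw [h, Fin.sum_univ_two]
    simp [hK, krausChannel, Matrix.mul_add, Matrix.add_mul, Matrix.mul_assoc]
  set N : Matrix (Fin 2 × Fin 2) (Fin 2) ℂ := Matrix.of fun p k => K k p.2 p.1 with hN
  have hchoi : (Matrix.of fun p q : Fin 2 × Fin 2 => Φ (Matrix.single p.1 q.1 1) p.2 q.2)
      = N * Nᴴ := by
    ext ⟨a, b⟩ ⟨a', b'⟩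
    rw [Matrix.of_apply, hΦ, Matrix.sum_apply, Matrix.mul_apply]
    refine Finset.sum_congr rfl fun k _ => ?_
    rw [Matrix.mul_apply, Finset.sum_eq_single a']
    · simp [hN, Matrix.mul_apply, Matrix.single_apply, Finset.sum_ite_eq]
    · intro c _ hc
      simp [Matrix.mul_apply, hc.symm]
    · simp
  rw [choiRank, hchoi, Matrix.rank_self_mul_conjTranspose, ← Matrix.rank_conjTranspose_mul_self]
  congr 1
  have hG : ∀ k l, (Nᴴ * N) k l = ((![krausPlus u v, krausMinus u v] k)ᴴ
      * ![krausPlus u v, krausMinus u v] l).trace := by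
    intro k l
    rw [← trace_conjTranspose_mul_unitary hU hV, trace_conjTranspose_mul_fin_two, Matrix.mul_apply,
      Fintype.sum_prod_type, Fin.sum_univ_two, Fin.sum_univ_two, Fin.sum_univ_two]
    simp only [hN, hK, Matrix.conjTranspose_apply, Matrix.of_apply]
    ring
  ext k l
  rw [hG]
  fin_cases k <;> fin_cases l
  · exact trace_krausPlus_krausPlus u v
  · change ((krausPlus u v)ᴴ * krausMinus u v).trace = _
    rw [trace_conjTranspose_mul_fin_two, krausPlus_eq, krausMinus_eq]
    simp
  · change ((krausMinus u v)ᴴ * krausPlus u v).trace = _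
    rw [trace_conjTranspose_mul_fin_two, krausPlus_eq, krausMinus_eq]
    simp
  · exact trace_krausMinus_krausMinus u v

theorem rank_diagonal_fin_two (a b : ℂ) :
    (Matrix.diagonal ![a, b]).rank = (if a ≠ 0 then 1 else 0) + (if b ≠ 0 then 1 else 0) := by
  rw [Matrix.rank_diagonal, Fintype.card_subtype, Finset.card_filter, Fin.sum_univ_two]
  rfl

theorem krausPlus_krausMinus_complete (u v : ℝ) :
    (krausPlus u v)ᴴ * krausPlus u v + (krausMinus u v)ᴴ * krausMinus u v = 1 := by
  rw [← krausIsometry_isometry u v]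
  ext i j
  simp [Matrix.mul_apply, Fintype.sum_prod_type, Fin.sum_univ_two, krausIsometry]
  ring

theorem exists_unitary_of_krausChannel_eq_conjMap {Φ : QubitMap} {u v : ℝ}
    (h : UnitarilyEquivalent Φ (krausChannel u v)) {A : Matrix (Fin 2) (Fin 2) ℂ} (hA : Aᴴ * A = 1)
    (hK : krausChannel u v = conjMap A) :
    ∃ U ∈ Matrix.unitaryGroup (Fin 2) ℂ, ∀ ρ, Φ ρ = U * ρ * star U := by
  obtain ⟨U, hU, V, hV, h⟩ := h
  refine ⟨U * A * V, mul_mem (mul_mem hU (Matrix.mem_unitaryGroup_iff'.2 hA)) hV, fun ρ => ?_⟩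
  rw [h, hK, conjMap_apply]
  simp [Matrix.mul_assoc, Matrix.star_eq_conjTranspose]

/-- The Gram eigenvalues 1 ± cos u cos v add up to 2, so at most one is zero. Then that Kraus
operator vanishes, and completeness makes the other unitary. -/
theorem choiRank_eq_two_or_unitary {Φ : QubitMap} {u v : ℝ}
    (h : UnitarilyEquivalent Φ (krausChannel u v)) : choiRank Φ = 2 ∨
      (choiRank Φ = 1 ∧ ∃ U ∈ Matrix.unitaryGroup (Fin 2) ℂ, ∀ ρ, Φ ρ = U * ρ * star U) := by
  have hc := krausPlus_krausMinus_complete u v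
  have hp := trace_krausPlus_krausPlus u v
  have hm := trace_krausMinus_krausMinus u v
  rw [choiRank_of_unitarilyEquivalent h, rank_diagonal_fin_two]
  by_cases h1 : 1 + ((Real.cos u * Real.cos v : ℝ) : ℂ) = 0
  · have h2 : 1 - ((Real.cos u * Real.cos v : ℝ) : ℂ) ≠ 0 := fun h2 => by
      have : (2 : ℂ) = 0 := by linear_combination h1 + h2
      norm_num at this
    rw [h1, Matrix.trace_conjTranspose_mul_self_eq_zero_iff] at hp
    refine Or.inr ⟨by rw [if_neg (not_not.2 h1), if_pos h2], ?_⟩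
    refine exists_unitary_of_krausChannel_eq_conjMap h (A := krausMinus u v)
      (by simpa [hp] using hc) (LinearMap.ext fun ρ => ?_)
    simp [krausChannel, conjMap_apply, hp]
  · by_cases h2 : 1 - ((Real.cos u * Real.cos v : ℝ) : ℂ) = 0
    · rw [h2, Matrix.trace_conjTranspose_mul_self_eq_zero_iff] at hm
      refine Or.inr ⟨by rw [if_pos h1, if_neg (not_not.2 h2)], ?_⟩
      refine exists_unitary_of_krausChannel_eq_conjMap h (A := krausPlus u v)
        (by simpa [hm] using hc) (LinearMap.ext fun ρ => ?_)
      simp [krausChannel, conjMap_apply, hm]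
    · exact Or.inl (by rw [if_pos h1, if_pos h2])

end

theorem mainTheorem11 :
    -- the Kraus form and the Bloch form agree, and define channels
    (∀ u v : ℝ, krausChannel u v = blochChannel u v ∧ IsChannel (krausChannel u v)) ∧
    -- classification of the degradable qubit channels
    (∀ Φ : QubitMap, IsChannel Φ →
      (IsDegradable Φ ↔
        ∃ u v : ℝ, |Real.sin v| ≤ |Real.cos u| ∧ UnitarilyEquivalent Φ (krausChannel u v))) ∧
    -- they have Choi rank two, apart from the unitary conjugations, which have Choi rank one
    (∀ Φ : QubitMap, IsChannel Φ → IsDegradable Φ →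
      choiRank Φ = 2 ∨
        (choiRank Φ = 1 ∧ ∃ U ∈ Matrix.unitaryGroup (Fin 2) ℂ, ∀ ρ, Φ ρ = U * ρ * star U)) ∧
    -- anti-degradability in the complementary range
    (∀ (Φ : QubitMap) (u v : ℝ), |Real.cos u| ≤ |Real.sin v| →
      UnitarilyEquivalent Φ (krausChannel u v) → IsAntiDegradable Φ) ∧
    -- the complement of `Φ(u,v)`
    (∀ u v : ℝ, IsComplementary (blochChannel u v)
      (blochChannel (v - Real.pi / 2) (u - Real.pi / 2))) ∧
    -- the degrading map: any admissible choice of angles, and an explicit one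
    (∀ u v : ℝ, |Real.sin v| ≤ |Real.cos u| →
      (∀ θ₁ θ₂ : ℝ, Real.cos u * Real.cos θ₁ = Real.sin v →
        Real.cos v * Real.cos θ₂ = Real.sin u →
        0 ≤ (Real.cos u * Real.cos v) * (Real.sin θ₁ * Real.sin θ₂) →
        blochChannel θ₁ θ₂ ∘ₗ blochChannel u v =
          blochChannel (v - Real.pi / 2) (u - Real.pi / 2)) ∧
      blochChannel
          ((if Real.cos u * Real.cos v < 0 then -1 else 1) *
            Real.arccos (Real.sin v / Real.cos u))
          (Real.arccos (Real.sin u / Real.cos v)) ∘ₗ blochChannel u v =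
        blochChannel (v - Real.pi / 2) (u - Real.pi / 2)) := by
  exact ⟨fun u v => ⟨krausChannel_eq_blochChannel u v, isChannel_krausChannel u v⟩,
    fun Φ hΦ => ⟨fun h => h.exists_unitarilyEquivalent hΦ,
      fun ⟨_, _, huv, h⟩ => h.isDegradable huv⟩,
    fun Φ hΦ hdeg => by
      obtain ⟨_, _, -, h⟩ := hdeg.exists_unitarilyEquivalent hΦ
      exact choiRank_eq_two_or_unitary h,
    fun _ _ _ huv h => h.isAntiDegradable huv,
    isComplementary_blochChannel,
    fun _ _ huv => ⟨fun _ _ => blochChannel_degrading huv, blochChannel_arccos_degrading huv⟩⟩
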